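/- Let $(X,d)$ be a proper metric space (hence complete and separable), $A\subseteq X$ a closed non-empty subset, and $p\in[1,\infty)$. Put $\Omega=X\setminus A$ and $E_\Omega=(X\times X)\setminus(A\times A)$. Let $\mathcal M_p(X,A)$ be the set of non-negative Radon measures $\mu$ on $\Omega$ with $\int_\Omega d(x,A)^p\,d\mu(x)<\infty$. For $\mu,\nu\in\mathcal M_p(X,A)$, let $\mathrm{Adm}(\mu,\nu)$ be the set of non-negative Borel measures $\gamma$ on $E_\Omega$ with $(\pi^1_\#\gamma)|_\Omega=\mu$ and $(\pi^2_\#\gamma)|_\Omega=\nu$, let $$\mathrm{Wb}_p(\mu,\nu)=\inf_{\gamma\in\mathrm{Adm}(\mu,\nu)}\Big(\int_{E_\Omega}d(x,y)^p\,d\gamma(x,y)\Big)^{1/p},$$ and let $\mathrm{Opt}(\mu,\nu)$ be the set of optimal partial plans, that is, of those $\gamma\in\mathrm{Adm}(\mu,\nu)$ with $\int_{E_\Omega}d(x,y)^p\,d\gamma=\mathrm{Wb}_p(\mu,\nu)^p$; the distance on $\mathcal M_p(X,A)$ is $\mathrm{Wb}_p$. A (constant speed) geodesic in a metric space $(Y,\rho)$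 is a continuous curve $\xi\colon[0,1]\to Y$ such that $\rho(\xi_s,\xi_t)=\rho(\xi_0,\xi_1)|s-t|$ for all $s,t\in[0,1]$; $Y$ is geodesic if any two of its points are the endpoints $\xi_0,\xi_1$ of a geodesic $\xi$. Let $\mathrm{Geo}(X)$ be the space of geodesics of $X$ with the uniform metric, and $e_t(\xi)=\xi_t$. Suppose that $X$ is geodesic. Then $\mathcal M_p(X,A)$ is geodesic. Moreover, if $p>1$ and $(\mu_t)_{t\in[0,1]}$ is a constant speed geodesic in $\mathcal M_p(X,A)$, then there exists a non-negative Borel measure $\boldsymbol\gamma$ on $\mathrm{Geo}(X)$ such that $$\big((e_0,e_1)_\#\boldsymbol\gamma\big)|_{E_\Omega}\in\mathrm{Opt}(\mu_0,\mu_1)\qquad\text{and}\qquad \mu_t=\big((e_t)_\#\boldsymbol\gamma\big)|_\Omega\quad\text{for all }t\in[0,1].$$ -/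

import Mathlib

open MeasureTheory
open scoped ENNReal

namespace PartialTransport

/-! ### Geodesics -/

/-- Constant speed geodesics parametrised by `[0,1]`. Continuity of the curve is a consequence of
the identity (see `IsGeodesicCurve.continuous`). -/
def IsGeodesicCurve {Y : Type*} [Dist Y] (ξ : unitInterval → Y) : Prop :=
  ∀ s t : unitInterval, dist (ξ s) (ξ t) = dist (ξ 0) (ξ 1) * |(s : ℝ) - (t : ℝ)|

/-- Any two points are joined by a constant speed geodesic. -/
def IsGeodesicSpace (Y : Type*) [Dist Y] : Prop :=
  ∀ x y : Y, ∃ ξ : unitInterval → Y, IsGeodesicCurve ξ ∧ ξ 0 = x ∧ ξ 1 = y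

theorem IsGeodesicCurve.continuous {Y : Type*} [PseudoMetricSpace Y] {ξ : unitInterval → Y}
    (h : IsGeodesicCurve ξ) : Continuous ξ :=
  (LipschitzWith.of_dist_le_mul (K := ⟨dist (ξ 0) (ξ 1), dist_nonneg⟩)
    (fun s t => (h s t).le)).continuous

/-- The space `Geo(X)` of constant speed geodesics of `X`, a subspace of `C([0,1], X)` with the
uniform metric. -/
abbrev Geo (X : Type*) [MetricSpace X] : Type _ :=
  {ξ : C(unitInterval, X) // IsGeodesicCurve (ξ : unitInterval → X)}

/-- `Geo(X)` carries its Borel σ-algebra. -/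
instance instMeasurableSpaceGeo (X : Type*) [MetricSpace X] : MeasurableSpace (Geo X) :=
  borel (Geo X)

instance instBorelSpaceGeo (X : Type*) [MetricSpace X] : BorelSpace (Geo X) := ⟨rfl⟩

/-- The evaluation map `e_t`. -/
def evalGeo {X : Type*} [MetricSpace X] (t : unitInterval) (ξ : Geo X) : X := ξ.1 t

theorem continuous_evalGeo {X : Type*} [MetricSpace X] (t : unitInterval) :
    Continuous (evalGeo (X := X) t) :=
  (continuous_eval_const t).comp continuous_subtype_val

/-! ### Measures and partial transport plans -/

/-- `Ω = X ∖ A`. -/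
abbrev Omega {X : Type*} (A : Set X) : Set X := Aᶜ

/-- `E_Ω = (X × X) ∖ (A × A)`. -/
abbrev EOmega {X : Type*} (A : Set X) : Set (X × X) := (A ×ˢ A)ᶜ

/-- The restriction `ν|_S` of a measure `ν` on `Z`, as a measure on the subspace `S`, i.e.
`restrictTo S ν B = ν B` for measurable `B ⊆ S` (used for measurable `S` only). -/
noncomputable def restrictTo {Z : Type*} [MeasurableSpace Z] (S : Set Z) (ν : Measure Z) :
    Measure S :=
  Measure.comap Subtype.val ν

/-- Radon measures: finite on compact sets, and inner regular, i.e. the measure of every measurable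
set is approximated from below by the measures of its compact subsets. -/
def IsRadon {Z : Type*} [TopologicalSpace Z] [MeasurableSpace Z] (μ : Measure Z) : Prop :=
  IsFiniteMeasureOnCompacts μ ∧ μ.InnerRegular

section Pair

variable {X : Type*} [MetricSpace X] [MeasurableSpace X]

/-- The space `M_p(X, A)`: Radon measures `μ` on `Ω` with `∫_Ω d(x,A)^p dμ < ∞`. -/
def Mp (A : Set X) (p : ℝ) : Type _ :=
  {μ : Measure (Omega A) //
    IsRadon μ ∧ ∫⁻ x : Omega A, Metric.infEDist (x : X) A ^ p ∂μ < ∞}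

/-- `Adm(μ, ν)`: Borel measures on `E_Ω` whose marginals restricted to `Ω` are `μ` and `ν`. -/
def Adm (A : Set X) (μ ν : Measure (Omega A)) : Set (Measure (EOmega A)) :=
  {γ | restrictTo (Omega A) (γ.map (fun z => z.1.1)) = μ ∧
       restrictTo (Omega A) (γ.map (fun z => z.1.2)) = ν}

/-- The cost `C(γ) = ∫_{E_Ω} d(x,y)^p dγ(x,y)`. -/
noncomputable def cost (A : Set X) (p : ℝ) (γ : Measure (EOmega A)) : ℝ≥0∞ :=
  ∫⁻ z : EOmega A, edist z.1.1 z.1.2 ^ p ∂γ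

/-- `Wb_p(μ, ν)`, as an extended number; it is finite on `M_p(X, A)`, see `Wb_lt_top`. -/
noncomputable def Wb (A : Set X) (p : ℝ) (μ ν : Measure (Omega A)) : ℝ≥0∞ :=
  ⨅ γ ∈ Adm A μ ν, cost A p γ ^ (1 / p)

/-- Optimal partial transport plans. -/
def Opt (A : Set X) (p : ℝ) (μ ν : Measure (Omega A)) : Set (Measure (EOmega A)) :=
  {γ | γ ∈ Adm A μ ν ∧ cost A p γ = Wb A p μ ν ^ p}

/-- The distance of `M_p(X, A)`. -/
noncomputable instance instDistMp (A : Set X) (p : ℝ) : Dist (Mp A p) :=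
  ⟨fun μ ν => (Wb A p μ.1 ν.1).toReal⟩

end Pair

/-! ### Finiteness of the distance -/

section Finite

variable {X : Type*} [MetricSpace X] [ProperSpace X] [MeasurableSpace X] [BorelSpace X]

/-- A measurable map `X → A` which is a projection onto `A` up to a factor `2`. -/
theorem exists_almost_proj (A : Set X) (hA : IsClosed A) (hne : A.Nonempty) :
    ∃ T : X → X, Measurable T ∧ (∀ x, T x ∈ A) ∧
      ∀ x ∉ A, edist x (T x) ≤ 2 * Metric.infEDist x A := by
  classical
  have : Nonempty A := hne.to_subtype
  obtain ⟨a, ha⟩ := TopologicalSpace.exists_dense_seq A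
  have key : ∀ x : X, ∃ n : ℕ, x ∈ A ∨ edist x (a n : X) < 2 * Metric.infEDist x A := by
    intro x
    by_cases hx : x ∈ A
    · exact ⟨0, Or.inl hx⟩
    have hpos : Metric.infEDist x A ≠ 0 := by
      intro h
      exact hx ((Metric.mem_iff_infEDist_zero_of_closed hA).2 h)
    have hfin : Metric.infEDist x A ≠ ∞ := Metric.infEDist_ne_top hne
    have hlt : Metric.infEDist x A < 2 * Metric.infEDist x A := by
      rw [two_mul]; exact ENNReal.lt_add_right hfin hpos
    obtain ⟨y, hy, hxy⟩ := Metric.infEDist_lt_iff.1 hlt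
    have hopen : IsOpen {z : A | edist x (z : X) < 2 * Metric.infEDist x A} :=
      isOpen_lt (by fun_prop) continuous_const
    obtain ⟨_, hz, ⟨n, rfl⟩⟩ := ha.inter_open_nonempty _ hopen ⟨⟨y, hy⟩, hxy⟩
    exact ⟨n, Or.inr hz⟩
  refine ⟨fun x => (a (Nat.find (key x)) : X), ?_, fun x => (a _).2, fun x hx => ?_⟩
  · refine Measurable.find (f := fun n _ => (a n : X)) (fun n => measurable_const) (fun n => ?_) key
    have h1 : MeasurableSet {x : X | edist x (a n : X) < 2 * Metric.infEDist x A} :=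
      measurableSet_lt (by fun_prop) (measurable_infEDist.const_mul 2)
    exact hA.measurableSet.union h1
  · rcases Nat.find_spec (key x) with h | h
    · exact absurd h hx
    · exact h.le

theorem restrictTo_apply {Z : Type*} [MeasurableSpace Z] {S : Set Z} (hS : MeasurableSet S)
    (ν : Measure Z) {s : Set S} (hs : MeasurableSet s) :
    restrictTo S ν s = ν (Subtype.val '' s) :=
  Measure.comap_apply _ Subtype.val_injective (fun _ h => hS.subtype_image h) _ hs

theorem Wb_lt_top (A : Set X) (hA : IsClosed A) (hne : A.Nonempty) (p : ℝ) (hp : 1 ≤ p)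
    (μ ν : Mp A p) : Wb A p μ.1 ν.1 < ∞ := by
  obtain ⟨T, hT, hTA, hd⟩ := exists_almost_proj A hA hne
  have hp0 : 0 ≤ p := by linarith
  have hm : MeasurableSet (Omega A) := hA.measurableSet.compl
  let f : Omega A → EOmega A := fun x => ⟨((x : X), T x), fun h => x.2 h.1⟩
  let g : Omega A → EOmega A := fun x => ⟨(T x, (x : X)), fun h => x.2 h.2⟩
  have hf : Measurable f :=
    (measurable_subtype_coe.prodMk (hT.comp measurable_subtype_coe)).subtype_mk
  have hg : Measurable g :=
    ((hT.comp measurable_subtype_coe).prodMk measurable_subtype_coe).subtype_mk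
  have m1 : Measurable fun z : EOmega A => z.1.1 := measurable_fst.comp measurable_subtype_coe
  have m2 : Measurable fun z : EOmega A => z.1.2 := measurable_snd.comp measurable_subtype_coe
  have hval : ∀ (ρ : Measure (Omega A)) (s : Set (Omega A)), MeasurableSet s →
      ρ.map (fun x : Omega A => (x : X)) (Subtype.val '' s) = ρ s := by
    intro ρ s hs
    rw [Measure.map_apply measurable_subtype_coe (hm.subtype_image hs),
      Set.preimage_image_eq _ Subtype.val_injective]
  have hnull : ∀ (ρ : Measure (Omega A)) (s : Set (Omega A)), MeasurableSet s →
      ρ.map (fun x : Omega A => T x) (Subtype.val '' s) = 0 := by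
    intro ρ s hs
    have hTm : Measurable fun x : Omega A => T x := hT.comp measurable_subtype_coe
    rw [Measure.map_apply hTm (hm.subtype_image hs)]
    convert measure_empty (μ := ρ)
    ext x
    simp only [Set.mem_preimage, Set.mem_image, Set.mem_empty_iff_false, iff_false]
    rintro ⟨y, -, hy⟩
    exact y.2 (hy ▸ hTA x)
  have hadm : μ.1.map f + ν.1.map g ∈ Adm A μ.1 ν.1 := by
    constructor
    · ext s hs
      rw [restrictTo_apply hm _ hs, Measure.map_add _ _ m1, Measure.map_map m1 hf,
        Measure.map_map m1 hg, Measure.add_apply]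
      exact (congrArg₂ (· + ·) (hval μ.1 s hs) (hnull ν.1 s hs)).trans (add_zero _)
    · ext s hs
      rw [restrictTo_apply hm _ hs, Measure.map_add _ _ m2, Measure.map_map m2 hf,
        Measure.map_map m2 hg, Measure.add_apply]
      exact (congrArg₂ (· + ·) (hnull μ.1 s hs) (hval ν.1 s hs)).trans (zero_add _)
  have hbound : ∀ ρ : Mp A p, ∫⁻ x : Omega A, edist (x : X) (T x) ^ p ∂ρ.1 < ∞ := by
    intro ρ
    calc ∫⁻ x : Omega A, edist (x : X) (T x) ^ p ∂ρ.1
        ≤ ∫⁻ x : Omega A, 2 ^ p * Metric.infEDist (x : X) A ^ p ∂ρ.1 := by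
          refine lintegral_mono fun x => ?_
          rw [← ENNReal.mul_rpow_of_nonneg _ _ hp0]
          exact ENNReal.rpow_le_rpow (hd x x.2) hp0
      _ = 2 ^ p * ∫⁻ x : Omega A, Metric.infEDist (x : X) A ^ p ∂ρ.1 :=
          lintegral_const_mul' _ _ (ENNReal.rpow_ne_top_of_nonneg hp0 (by simp))
      _ < ∞ := ENNReal.mul_lt_top (ENNReal.rpow_lt_top_of_nonneg hp0 (by simp)) ρ.2.2
  have mc : Measurable fun z : EOmega A => edist z.1.1 z.1.2 ^ p := (m1.edist m2).pow_const p
  have hcost : cost A p (μ.1.map f + ν.1.map g) < ∞ := by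
    rw [cost, lintegral_add_measure, lintegral_map mc hf, lintegral_map mc hg]
    refine ENNReal.add_lt_top.2 ⟨hbound μ, ?_⟩
    simpa only [g, edist_comm] using hbound ν
  exact (iInf₂_le _ hadm).trans_lt (ENNReal.rpow_lt_top_of_nonneg (by positivity) hcost.ne)

end Finite

end PartialTransport

open PartialTransport

namespace PartialTransport

open Filter Topology ProbabilityTheory
open scoped NNReal

/-! ### Borel sections -/

/-! Measures on `Geo X` mediate between plans and curves of measures. If `Γ` on `Geo X` has `∫
d(e₀,e₁)^p ≤ W^p`, then `(e_s,e_t)` pushes `Γ` to a plan of cost at most `(|s-t| W)^p`, so its time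
marginals on `Ω` form a `W`-Lipschitz curve (`exists_curve`). For existence of geodesics, an optimal
plan (`exists_optimal_plan`) is pushed to `Geo X` by a Borel choice of geodesic between its
endpoints (`exists_measurable_section`). The resulting curve is Lipschitz with constant the distance
of its ends, and the triangle inequality upgrades this to constant speed.

For the lift with `p > 1`, optimal plans between consecutive times `i/N` are glued into a measure on
chains (`exists_chain`). Integrating `d(z₀,z_N)^p ≤ N^(p-1) ∑ d(z_i,z_{i+1})^p` gives `W^p` on both
sides, so equality holds almost everywhere, and strict convexity makes almost every chain a discrete
geodesic (`exists_geodesic_chain`). Interpolating in a Borel way yields a lift that is correct on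
the grid. Along dyadic grids these lifts have a limit which is correct at all dyadic times and costs
at most `W^p` (`exists_limit_of_marginals`). Its marginal curve and the given geodesic are both
Lipschitz and agree at dyadic times, hence everywhere.

The masses may be infinite near `A`, and on `A` nothing is prescribed. Gluing therefore adds
stationary mass on `A`, which is free and invisible on `Ω`, and limits are vague limits taken away
from `A`, with the cost bound playing the role of tightness. -/

/-- A compact metric space is a continuous image of the Cantor set, whose points are linearly
ordered. Taking the least point of each fibre is Borel, because its sublevel sets within the range
are images of compact sets. -/
theorem exists_measurable_section_of_compactSpace {K Y : Type*} [MetricSpace K] [CompactSpace K]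
    [Nonempty K] [MeasurableSpace K] [BorelSpace K] [TopologicalSpace Y] [T2Space Y]
    [MeasurableSpace Y] [BorelSpace Y] {F : K → Y} (hF : Continuous F) :
    ∃ S : Y → K, Measurable S ∧ ∀ y ∈ Set.range F, F (S y) = y := by
  classical
  obtain ⟨g₀, hg₀, hs₀⟩ := exists_nat_bool_continuous_surjective_of_compact K
  let g : cantorSet → K := g₀ ∘ cantorSetHomeomorphNatToBool
  have hg : Continuous g := hg₀.comp cantorSetHomeomorphNatToBool.continuous
  have hs : Function.Surjective g := hs₀.comp cantorSetHomeomorphNatToBool.surjective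
  let H : cantorSet → Y := F ∘ g
  have hH : Continuous H := hF.comp hg
  have : CompactSpace cantorSet := isCompact_iff_compactSpace.1 isCompact_cantorSet
  let fib : Y → Set ℝ := fun y => Subtype.val '' (H ⁻¹' {y})
  have hfibc : ∀ y, IsCompact (fib y) := fun y =>
    ((isClosed_singleton.preimage hH).isCompact).image continuous_subtype_val
  have hfibn : ∀ y ∈ Set.range F, (fib y).Nonempty := by
    rintro _ ⟨k, rfl⟩
    obtain ⟨x, rfl⟩ := hs k
    exact ⟨x, x, rfl, rfl⟩
  let m : Y → ℝ := fun y => sInf (fib y)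
  have hm_mem : ∀ y ∈ Set.range F, m y ∈ fib y := fun y hy => (hfibc y).sInf_mem (hfibn y hy)
  have hR : IsClosed (Set.range F) := (isCompact_range hF).isClosed
  have hm : Measurable m := by
    refine measurable_of_Iic fun a => ?_
    have hcl : IsClosed (H '' {x | (x : ℝ) ≤ a}) :=
      ((isClosed_le continuous_subtype_val continuous_const).isCompact.image hH).isClosed
    -- Off the range the fibre is empty and `sInf ∅ = 0`, which accounts for the second piece.
    have heq : m ⁻¹' Set.Iic a =
        H '' {x | (x : ℝ) ≤ a} ∪ ((Set.range F)ᶜ ∩ {_y | (0 : ℝ) ≤ a}) := by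
      ext y
      by_cases hy : y ∈ Set.range F
      · simp only [Set.mem_preimage, Set.mem_Iic, Set.mem_union, Set.mem_inter_iff,
          Set.mem_compl_iff, hy, not_true, false_and, or_false]
        constructor
        · intro h
          obtain ⟨x, hx, hxm⟩ := hm_mem y hy
          exact ⟨x, by simpa only [Set.mem_ofPred_eq, hxm] using h, hx⟩
        · rintro ⟨x, hx, rfl⟩
          exact (csInf_le (hfibc _).bddBelow ⟨x, rfl, rfl⟩).trans hx
      · have hf : fib y = ∅ := by
          refine Set.eq_empty_of_forall_notMem ?_
          rintro _ ⟨x, hx, rfl⟩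
          exact hy ⟨g x, hx⟩
        have h2 : y ∉ H '' {x | (x : ℝ) ≤ a} := by
          rintro ⟨x, -, rfl⟩
          exact hy ⟨g x, rfl⟩
        simp [m, hf, hy, h2, Real.sInf_empty, -Set.mem_range]
    rw [heq]
    exact hcl.measurableSet.union (hR.measurableSet.compl.inter (MeasurableSet.const _))
  let x₀ : cantorSet := cantorSetHomeomorphNatToBool.symm fun _ => false
  let P : ℝ → cantorSet := fun x => if h : x ∈ cantorSet then ⟨x, h⟩ else x₀
  have hP : Measurable P :=
    Measurable.dite (s := cantorSet) measurable_id measurable_const isClosed_cantorSet.measurableSet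
  refine ⟨fun y => g (P (m y)), hg.measurable.comp (hP.comp hm), fun y hy => ?_⟩
  obtain ⟨x, hx, hxm⟩ := hm_mem y hy
  have : P (m y) = x := by
    rw [← hxm]
    simp [P]
  change F (g (P (m y))) = y
  rw [this]
  exact hx

/-- The compact sections are patched along a countable compact covering, using at `y` the first
piece whose image contains `y`. -/
theorem exists_measurable_section {G Y : Type*} [MetricSpace G] [SigmaCompactSpace G] [Nonempty G]
    [MeasurableSpace G] [BorelSpace G] [TopologicalSpace Y] [T2Space Y]
    [MeasurableSpace Y] [BorelSpace Y] {F : G → Y} (hF : Continuous F) :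
    ∃ S : Y → G, Measurable S ∧ ∀ y ∈ Set.range F, F (S y) = y := by
  classical
  obtain ⟨g₀⟩ := ‹Nonempty G›
  have key : ∀ n : ℕ, ∃ S : Y → G, Measurable S ∧ ∀ y ∈ F '' compactCovering G n, F (S y) = y := by
    intro n
    rcases (compactCovering G n).eq_empty_or_nonempty with h | h
    · exact ⟨fun _ => g₀, measurable_const, by simp [h]⟩
    · have := h.to_subtype
      have : CompactSpace (compactCovering G n) :=
        isCompact_iff_compactSpace.1 (isCompact_compactCovering G n)
      obtain ⟨S, hS, hSF⟩ := exists_measurable_section_of_compactSpace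
        (F := fun x : compactCovering G n => F x) (hF.comp continuous_subtype_val)
      refine ⟨fun y => S y, measurable_subtype_coe.comp hS, ?_⟩
      rintro y ⟨x, hx, rfl⟩
      exact hSF _ ⟨⟨x, hx⟩, rfl⟩
  choose S hS hSF using key
  have hcl : ∀ n, IsClosed (F '' compactCovering G n) := fun n =>
    ((isCompact_compactCovering G n).image hF).isClosed
  have hRm : MeasurableSet (Set.range F) := by
    rw [← Set.image_univ, ← iUnion_compactCovering G, Set.image_iUnion]
    exact MeasurableSet.iUnion fun n => (hcl n).measurableSet
  have hex : ∀ y, ∃ n, y ∉ Set.range F ∨ y ∈ F '' compactCovering G n := by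
    intro y
    by_cases hy : y ∈ Set.range F
    · obtain ⟨x, rfl⟩ := hy
      obtain ⟨n, hn⟩ := exists_mem_compactCovering x
      exact ⟨n, Or.inr ⟨x, hn, rfl⟩⟩
    · exact ⟨0, Or.inl hy⟩
  refine ⟨fun y => S (Nat.find (hex y)) y, ?_, fun y hy => ?_⟩
  · exact Measurable.find (f := fun n y => S n y)
      (p := fun n y => y ∉ Set.range F ∨ y ∈ F '' compactCovering G n) hS
      (fun n => hRm.compl.union (hcl n).measurableSet) hex
  · rcases Nat.find_spec (hex y) with h | h
    · exact absurd hy h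
    · exact hSF _ y h

/-! ### Disintegration and gluing -/

/-- Weighting `ρ` by a positive integrable function of the first coordinate makes it finite without
changing its conditional laws. The kernel of the weighted measure therefore serves `ρ` too. -/
theorem exists_kernel_eq_compProd {X Y : Type*} [MeasurableSpace X] [MeasurableSpace Y]
    [StandardBorelSpace Y] [Nonempty Y] (ρ : Measure (X × Y)) [SigmaFinite ρ.fst] :
    ∃ κ : Kernel X Y, IsMarkovKernel κ ∧ ρ = ρ.fst ⊗ₘ κ := by
  obtain ⟨g, hg0, hgm, hgi⟩ := exists_pos_lintegral_lt_of_sigmaFinite ρ.fst one_ne_zero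
  have hgm' : Measurable fun x => (g x : ℝ≥0∞) := hgm.coe_nnreal_ennreal
  have hgm₁ : Measurable fun z : X × Y => (g z.1 : ℝ≥0∞) := hgm'.comp measurable_fst
  set ρ' := ρ.withDensity fun z => (g z.1 : ℝ≥0∞) with hρ'
  have hint : ∫⁻ z, (g z.1 : ℝ≥0∞) ∂ρ < 1 := by
    rwa [Measure.fst, lintegral_map hgm' measurable_fst] at hgi
  have : IsFiniteMeasure ρ' :=
    isFiniteMeasure_withDensity (hint.trans ENNReal.one_lt_top).ne
  have hfst : ρ'.fst = ρ.fst.withDensity fun x => (g x : ℝ≥0∞) := by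
    ext s hs
    rw [Measure.fst_apply hs, withDensity_apply _ (measurable_fst hs), withDensity_apply _ hs,
      Measure.fst, setLIntegral_map hs hgm' measurable_fst]
  obtain ⟨κ, hκ, hdis⟩ : ∃ κ : Kernel X Y, IsMarkovKernel κ ∧ ρ'.fst ⊗ₘ κ = ρ' :=
    ⟨ρ'.condKernel, inferInstance, ρ'.disintegrate _⟩
  refine ⟨κ, hκ, ?_⟩
  have hgne : ∀ x, (g x : ℝ≥0∞) ≠ 0 := fun x => by exact_mod_cast (hg0 x).ne'
  refine Measure.ext_of_lintegral _ fun f hf => ?_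
  have hf' : Measurable fun z : X × Y => (g z.1 : ℝ≥0∞)⁻¹ * f z :=
    hgm₁.inv.mul hf
  have h1 : ∫⁻ z, f z ∂ρ = ∫⁻ z, (g z.1 : ℝ≥0∞)⁻¹ * f z ∂ρ' := by
    rw [hρ', lintegral_withDensity_eq_lintegral_mul _ hgm₁ hf']
    refine lintegral_congr fun z => ?_
    simp only [Pi.mul_apply]
    rw [← mul_assoc, ENNReal.mul_inv_cancel (hgne _) ENNReal.coe_ne_top, one_mul]
  rw [h1, ← hdis, Measure.lintegral_compProd hf', Measure.lintegral_compProd hf]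
  rw [hfst, lintegral_withDensity_eq_lintegral_mul _ hgm' hf'.lintegral_kernel_prod_right']
  refine lintegral_congr fun x => ?_
  simp only [Pi.mul_apply]
  rw [lintegral_const_mul' _ _ (ENNReal.inv_ne_top.2 (hgne x)), ← mul_assoc,
    ENNReal.mul_inv_cancel (hgne _) ENNReal.coe_ne_top, one_mul]

theorem compProd_comap_map_prodMap {X Y Z : Type*} [MeasurableSpace X] [MeasurableSpace Y]
    [MeasurableSpace Z] {f : Z → X} (hf : Measurable f) (σ : Measure Z) [SFinite σ]
    (κ : Kernel X Y) [IsMarkovKernel κ] :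
    (σ ⊗ₘ κ.comap f hf).map (Prod.map f id) = (σ.map f) ⊗ₘ κ := by
  refine Measure.ext_of_lintegral _ fun φ hφ => ?_
  rw [lintegral_map hφ (hf.prodMap measurable_id),
    Measure.lintegral_compProd (f := fun z => φ (Prod.map f id z))
      (hφ.comp (hf.prodMap measurable_id)),
    Measure.lintegral_compProd hφ, lintegral_map hφ.lintegral_kernel_prod_right' hf]
  simp [Kernel.comap_apply]

/-- Gluing of a measure `σ` on `Z` with a partial plan `γ`, along a map `f : Z → X`. -/
theorem exists_glue {X Z : Type*} [MeasurableSpace X] [MeasurableSpace Z] [StandardBorelSpace X]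
    [Nonempty X] {A : Set X} (hA : MeasurableSet A)
    {f : Z → X} (hf : Measurable f) {c : X → Z} (hc : Measurable c) (hfc : ∀ x, f (c x) = x)
    (σ : Measure Z) (γ : Measure (X × X))
    (hσγ : (σ.map f).restrict Aᶜ = (γ.map Prod.fst).restrict Aᶜ)
    (hfin : SigmaFinite ((σ.map f).restrict Aᶜ)) :
    ∃ (τ : Measure (Z × X)) (a b : Measure X), a Aᶜ = 0 ∧ b Aᶜ = 0 ∧
      τ.map Prod.fst = σ + a.map c ∧
      τ.map (fun z => (f z.1, z.2)) = γ + b.map fun x => (x, x) := by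
  have hΩ : MeasurableSet Aᶜ := hA.compl
  set ρ := γ.restrict (Prod.fst ⁻¹' Aᶜ) with hρ
  have hρfst : ρ.fst = (σ.map f).restrict Aᶜ := by
    rw [hσγ, Measure.fst, hρ, Measure.restrict_map measurable_fst hΩ]
  have : SigmaFinite ρ.fst := hρfst ▸ hfin
  obtain ⟨κ, hκ, hρκ⟩ := exists_kernel_eq_compProd ρ
  set σ₁ := σ.restrict (f ⁻¹' Aᶜ) with hσ₁
  have hσ₁f : σ₁.map f = ρ.fst := by rw [hρfst, Measure.restrict_map hf hΩ]
  have : SigmaFinite (σ₁.map f) := hσ₁f ▸ this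
  have : SigmaFinite σ₁ := SigmaFinite.of_map σ₁ hf.aemeasurable this
  have hm2 : Measurable fun z : Z => (z, f z) := measurable_id.prodMk hf
  have hm3 : Measurable fun z : X × X => (c z.1, z.2) :=
    (hc.comp measurable_fst).prodMk measurable_snd
  have hmf : Measurable fun z : Z × X => (f z.1, z.2) :=
    (hf.comp measurable_fst).prodMk measurable_snd
  have hd : Measurable fun x : X => (x, x) := measurable_id.prodMk measurable_id
  -- Three pieces: mass with `f` in `Ω` continues by the kernel of `γ`; mass of `σ` with `f` in `A`
  -- stays where it is, which produces `b`; mass of `γ` starting in `A` receives the artificial past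
  -- `c`, which produces `a`. Only the first piece needs disintegration, hence σ-finiteness only on
  -- `Aᶜ`.
  refine ⟨(σ₁ ⊗ₘ κ.comap f hf) + (σ.restrict (f ⁻¹' A)).map (fun z => (z, f z))
    + (γ.restrict (Prod.fst ⁻¹' A)).map (fun z => (c z.1, z.2)),
    (γ.restrict (Prod.fst ⁻¹' A)).map Prod.fst, (σ.restrict (f ⁻¹' A)).map f, ?_, ?_, ?_, ?_⟩
  · rw [Measure.map_apply measurable_fst hΩ, Measure.restrict_apply (measurable_fst hΩ)]
    simp
  · rw [Measure.map_apply hf hΩ, Measure.restrict_apply (hf hΩ)]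
    simp
  · rw [Measure.map_add _ _ measurable_fst, Measure.map_add _ _ measurable_fst,
      Measure.map_map measurable_fst hm2, Measure.map_map measurable_fst hm3,
      Measure.map_map hc measurable_fst]
    congr 1
    change (σ₁ ⊗ₘ κ.comap f hf).fst + (σ.restrict (f ⁻¹' A)).map id = σ
    rw [Measure.fst_compProd, Measure.map_id, hσ₁, add_comm, Set.preimage_compl]
    exact Measure.restrict_add_restrict_compl (hf hA)
  · rw [Measure.map_add _ _ hmf, Measure.map_add _ _ hmf, Measure.map_map hmf hm2,
      Measure.map_map hmf hm3, Measure.map_map hd hf]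
    have h1 : (σ₁ ⊗ₘ κ.comap f hf).map (fun z : Z × X => (f z.1, z.2)) = ρ := by
      rw [hρκ, ← hσ₁f]
      exact compProd_comap_map_prodMap hf σ₁ κ
    have h3 : (fun z : Z × X => (f z.1, z.2)) ∘ (fun z : X × X => (c z.1, z.2)) = id := by
      ext z <;> simp [hfc]
    rw [h1, h3, Measure.map_id, add_right_comm]
    congr 1
    rw [hρ, add_comm, Set.preimage_compl]
    exact Measure.restrict_add_restrict_compl (measurable_fst hA)

/-! ### The space of geodesics -/

section GeodesicSpace

variable {X : Type*} [MetricSpace X]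

theorem isClosed_setOf_isGeodesicCurve :
    IsClosed {ξ : C(unitInterval, X) | IsGeodesicCurve (ξ : unitInterval → X)} := by
  have he : ∀ t : unitInterval, Continuous fun ξ : C(unitInterval, X) => ξ t :=
    fun t => continuous_eval_const t
  simp only [IsGeodesicCurve, Set.ofPred_forall]
  exact isClosed_iInter fun s => isClosed_iInter fun t =>
    isClosed_eq ((he s).dist (he t)) (((he 0).dist (he 1)).mul continuous_const)

theorem dist_evalGeo_le (ξ η : Geo X) (t : unitInterval) :
    dist (evalGeo t ξ) (evalGeo t η) ≤ dist ξ η :=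
  ContinuousMap.dist_apply_le_dist (f := ξ.1) (g := η.1) t

theorem dist_evalGeo_evalGeo (ξ : Geo X) (s t : unitInterval) :
    dist (evalGeo s ξ) (evalGeo t ξ) =
      dist (evalGeo 0 ξ) (evalGeo 1 ξ) * |(s : ℝ) - (t : ℝ)| := ξ.2 s t

/-- Arzelà–Ascoli: the geodesics in a ball are uniformly Lipschitz and take values in a fixed ball
of `X`. This supplies the σ-compactness needed for Borel sections and the compactness needed for
limits. -/
instance instProperSpaceGeo [ProperSpace X] : ProperSpace (Geo X) := by
  refine ⟨fun η r => ?_⟩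
  let Φ : Geo X → BoundedContinuousFunction unitInterval X := fun ξ =>
    ContinuousMap.isometryEquivBoundedOfCompact unitInterval X ξ.1
  have hΦ : IsClosedEmbedding Φ :=
    (ContinuousMap.isometryEquivBoundedOfCompact unitInterval X).toHomeomorph.isClosedEmbedding.comp
      isClosed_setOf_isGeodesicCurve.isClosedEmbedding_subtypeVal
  have hev : ∀ (ξ : Geo X) t, Φ ξ t = evalGeo t ξ := fun ξ t => rfl
  set D := dist (evalGeo 0 η) (evalGeo 1 η) with hD
  rw [hΦ.isEmbedding.isCompact_iff]
  refine BoundedContinuousFunction.arzela_ascoli₂ (Metric.closedBall (evalGeo 0 η) (r + D))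
    (isCompact_closedBall _ _) _ (hΦ.isClosedMap _ Metric.isClosed_closedBall) ?_ ?_
  · rintro _ t ⟨ξ, hξ, rfl⟩
    rw [hev, Metric.mem_closedBall]
    have h1 := dist_evalGeo_le ξ η t
    have h2 := dist_evalGeo_evalGeo η t 0
    have h3 : |(t : ℝ) - ((0 : unitInterval) : ℝ)| ≤ 1 := by
      simpa [abs_of_nonneg t.2.1] using t.2.2
    have h4 : dist (evalGeo t η) (evalGeo 0 η) ≤ D := by
      rw [h2]
      exact mul_le_of_le_one_right dist_nonneg h3
    exact (dist_triangle _ (evalGeo t η) _).trans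
      (add_le_add (h1.trans (Metric.mem_closedBall.1 hξ)) h4)
  -- The centre has length `D`, and each of the two endpoints moves by at most `r`.
  · refine (LipschitzWith.uniformEquicontinuous _ (Real.toNNReal (2 * r + D)) ?_).equicontinuous
    rintro ⟨_, ξ, hξ, rfl⟩
    refine LipschitzWith.of_dist_le_mul fun s t => ?_
    change dist (evalGeo s ξ) (evalGeo t ξ) ≤ _
    rw [dist_evalGeo_evalGeo]
    refine mul_le_mul_of_nonneg_right (le_trans ?_ (Real.le_coe_toNNReal _)) (abs_nonneg _)
    have h0 := dist_evalGeo_le ξ η 0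
    have h1 := dist_evalGeo_le ξ η 1
    have h2 := Metric.mem_closedBall.1 hξ
    have h3 := dist_triangle4 (evalGeo 0 ξ) (evalGeo 0 η) (evalGeo 1 η) (evalGeo 1 ξ)
    rw [dist_comm (evalGeo 1 η)] at h3
    linarith

/-- A discrete geodesic extends to a geodesic. -/
theorem exists_geo_of_discrete (hX : IsGeodesicSpace X) {N : ℕ} (hN : 0 < N) (z : ℕ → X)
    (hz : ∀ i < N, dist (z i) (z (i + 1)) = dist (z 0) (z N) / N) :
    ∃ ξ : Geo X, ∀ (t : unitInterval) (i : ℕ), (t : ℝ) = i / N → evalGeo t ξ = z i := by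
  have hNr : (0 : ℝ) < N := by exact_mod_cast hN
  set L := dist (z 0) (z N) with hL
  have hL0 : 0 ≤ L := dist_nonneg
  choose g hg hg0 hg1 using fun i => hX (z i) (z (i + 1))
  have hfr : ∀ t : unitInterval, Int.fract ((N : ℝ) * t) ∈ unitInterval := fun t =>
    ⟨Int.fract_nonneg _, (Int.fract_lt_one _).le⟩
  -- At `t = 1` the index is `N`, beyond the last segment, but the fractional part is `0`, so only
  -- the starting point `z N` of `g N` is used.
  let ξ : unitInterval → X := fun t => g ⌊(N : ℝ) * t⌋₊ ⟨Int.fract ((N : ℝ) * t), hfr t⟩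
  have hnn : ∀ t : unitInterval, 0 ≤ (N : ℝ) * t := fun t => mul_nonneg hNr.le t.2.1
  have hfle : ∀ t : unitInterval, ⌊(N : ℝ) * t⌋₊ ≤ N := fun t => by
    have : (N : ℝ) * t ≤ N := mul_le_of_le_one_right hNr.le t.2.2
    exact (Nat.floor_le_floor this).trans (by simp)
  have hfract : ∀ t : unitInterval, Int.fract ((N : ℝ) * t) = N * t - ⌊(N : ℝ) * t⌋₊ := fun t => by
    rw [natCast_floor_eq_intCast_floor (hnn t)]
    exact (Int.self_sub_floor _).symm
  have hval : ∀ (t : unitInterval) (i : ℕ), (t : ℝ) = i / N → ξ t = z i := by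
    intro t i hti
    have h1 : (N : ℝ) * t = i := by rw [hti]; field_simp
    have h2 : ⌊(N : ℝ) * t⌋₊ = i := by rw [h1]; simp
    have h3 : (⟨Int.fract ((N : ℝ) * t), hfr t⟩ : unitInterval) = 0 := by
      ext
      simp [h1]
    change g ⌊(N : ℝ) * t⌋₊ ⟨Int.fract ((N : ℝ) * t), hfr t⟩ = z i
    rw [h3, h2, hg0]
  have hchain : ∀ i j, i ≤ j → j ≤ N → dist (z i) (z j) ≤ L / N * (j - i) := by
    intro i j hij hj
    refine (dist_le_Ico_sum_of_dist_le hij (d := fun _ => L / N)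
      (fun {k} _ hk => (hz k (hk.trans_le hj)).le)).trans ?_
    rw [Finset.sum_const, Nat.card_Ico, nsmul_eq_mul, Nat.cast_sub hij, mul_comm]
  have hstart : ∀ t : unitInterval,
      dist (z ⌊(N : ℝ) * t⌋₊) (ξ t) ≤ L / N * (N * t - ⌊(N : ℝ) * t⌋₊) := by
    intro t
    rcases (hfle t).lt_or_eq with h | h
    · have := hg ⌊(N : ℝ) * t⌋₊ 0 ⟨Int.fract ((N : ℝ) * t), hfr t⟩
      rw [hg0, hg1, hz _ h] at this
      refine this.le.trans (le_of_eq ?_)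
      rw [Set.Icc.coe_zero, zero_sub, abs_neg, abs_of_nonneg (hfr t).1, hfract]
    · have ht : (t : ℝ) = (N : ℕ) / N := by
        rw [div_self hNr.ne']
        refine le_antisymm t.2.2 ?_
        have := Nat.floor_le (hnn t)
        rw [h] at this
        exact (le_mul_iff_one_le_right hNr).1 this
      rw [hval t N ht, h, dist_self]
      have := Nat.floor_le (hnn t)
      rw [h] at this
      exact mul_nonneg (div_nonneg hL0 hNr.le) (sub_nonneg.2 this)
  have hend : ∀ t : unitInterval, ⌊(N : ℝ) * t⌋₊ < N →
      dist (ξ t) (z (⌊(N : ℝ) * t⌋₊ + 1)) ≤ L / N * (⌊(N : ℝ) * t⌋₊ + 1 - N * t) := by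
    intro t h
    have := hg ⌊(N : ℝ) * t⌋₊ ⟨Int.fract ((N : ℝ) * t), hfr t⟩ 1
    rw [hg0, hg1, hz _ h] at this
    refine this.le.trans (le_of_eq ?_)
    rw [Set.Icc.coe_one, abs_sub_comm, abs_of_nonneg (sub_nonneg.2 (hfr t).2)]
    simp only [hfract]
    ring
  have hlip : ∀ s t : unitInterval, (s : ℝ) ≤ t → dist (ξ s) (ξ t) ≤ L * (t - s) := by
    intro s t hst
    have hmono : ⌊(N : ℝ) * s⌋₊ ≤ ⌊(N : ℝ) * t⌋₊ :=
      Nat.floor_le_floor (mul_le_mul_of_nonneg_left hst hNr.le)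
    have hLN : L * ((t : ℝ) - s) = L / N * (N * t - N * s) := by field_simp
    rcases hmono.lt_or_eq with h | h
    · have h1 := hend s (h.trans_le (hfle t))
      have h2 := hchain (⌊(N : ℝ) * s⌋₊ + 1) ⌊(N : ℝ) * t⌋₊ h (hfle t)
      have h3 := hstart t
      have h4 := dist_triangle4 (ξ s) (z (⌊(N : ℝ) * s⌋₊ + 1)) (z ⌊(N : ℝ) * t⌋₊) (ξ t)
      rw [hLN]
      push_cast at h2
      calc dist (ξ s) (ξ t) ≤ _ := h4
        _ ≤ _ := add_le_add (add_le_add h1 h2) h3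
        _ = _ := by ring
    · rcases (hfle s).lt_or_eq with h' | h'
      · have := hg ⌊(N : ℝ) * s⌋₊ ⟨Int.fract ((N : ℝ) * s), hfr s⟩ ⟨Int.fract ((N : ℝ) * t), hfr t⟩
        rw [hg0, hg1, hz _ h'] at this
        have hξt : ξ t = g ⌊(N : ℝ) * s⌋₊ ⟨Int.fract ((N : ℝ) * t), hfr t⟩ := by
          rw [h]
        rw [hξt]
        refine this.le.trans (le_of_eq ?_)
        rw [hLN]
        simp only [hfract]
        rw [abs_sub_comm, ← h, abs_of_nonneg] <;>
        [skip; linarith [mul_le_mul_of_nonneg_left hst hNr.le]]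
        ring
      · have h1 := Nat.floor_le (hnn s)
        rw [h'] at h1
        have h2 : (1 : ℝ) ≤ s := (le_mul_iff_one_le_right hNr).1 h1
        have : s = t := by
          ext
          linarith [t.2.2]
        rw [this, dist_self, sub_self, mul_zero]
  have h0 : ξ 0 = z 0 := hval 0 0 (by simp)
  have h1 : ξ 1 = z N := hval 1 N (by rw [div_self hNr.ne', Set.Icc.coe_one])
  -- The Lipschitz bounds on the three subintervals add up to `L`, the distance of the endpoints, so
  -- none of them is strict.
  have hgeo' : ∀ s t : unitInterval, (s : ℝ) ≤ t → dist (ξ s) (ξ t) = L * (t - s) := by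
    intro s t hst
    refine le_antisymm (hlip s t hst) ?_
    have e1 := hlip 0 s s.2.1
    have e2 := hlip t 1 t.2.2
    have e3 := dist_triangle4 (ξ 0) (ξ s) (ξ t) (ξ 1)
    rw [h0, h1] at e3
    rw [h0] at e1
    rw [h1] at e2
    simp only [Set.Icc.coe_zero, Set.Icc.coe_one] at e1 e2
    nlinarith
  have hgeo : IsGeodesicCurve ξ := by
    intro s t
    rw [h0, h1, ← hL]
    rcases le_total (s : ℝ) t with h | h
    · rw [hgeo' s t h, abs_sub_comm, abs_of_nonneg (sub_nonneg.2 h)]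
    · rw [dist_comm, hgeo' t s h, abs_of_nonneg (sub_nonneg.2 h)]
  exact ⟨⟨⟨ξ, hgeo.continuous⟩, hgeo⟩, hval⟩

end GeodesicSpace

/-! ### Vague limits -/

open scoped CompactlySupported in
-- Along an ultrafilter every sequence of integrals converges in `[0,∞]`. The local mass bounds keep
-- the limits finite on compactly supported functions, and the resulting positive functional is
-- represented by Riesz–Markov–Kakutani. The ultrafilter takes the place of a diagonal extraction.
theorem exists_vague_limit {Y : Type*} [TopologicalSpace Y] [T2Space Y] [LocallyCompactSpace Y]
    [MeasurableSpace Y] [BorelSpace Y] (Γ : ℕ → Measure Y)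
    (hΓ : ∀ y, ∃ V ∈ 𝓝 y, ∃ M : ℝ≥0∞, M ≠ ∞ ∧ ∀ᶠ n in atTop, Γ n V ≤ M) :
    ∃ (G : Measure Y) (U : Ultrafilter ℕ), G.Regular ∧ (U : Filter ℕ) ≤ atTop ∧
      ∀ f : C_c(Y, ℝ≥0), Tendsto (fun n => ∫⁻ y, f y ∂Γ n) U (𝓝 (∫⁻ y, f y ∂G)) := by
  have hU : (hyperfilter ℕ : Filter ℕ) ≤ atTop := Nat.hyperfilter_le_atTop
  set U := hyperfilter ℕ
  have hK : ∀ K : Set Y, IsCompact K → ∃ M : ℝ≥0∞, M ≠ ∞ ∧ ∀ᶠ n in atTop, Γ n K ≤ M := by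
    intro K hK
    refine hK.induction_on (p := fun s => ∃ M : ℝ≥0∞, M ≠ ∞ ∧ ∀ᶠ n in atTop, Γ n s ≤ M)
      ⟨0, by simp, by simp⟩ ?_ ?_ ?_
    · rintro s t hst ⟨M, hM, h⟩
      exact ⟨M, hM, h.mono fun n hn => (measure_mono hst).trans hn⟩
    · rintro s t ⟨M, hM, h⟩ ⟨M', hM', h'⟩
      refine ⟨M + M', ENNReal.add_ne_top.2 ⟨hM, hM'⟩, ?_⟩
      filter_upwards [h, h'] with n hn hn'
      exact (measure_union_le _ _).trans (add_le_add hn hn')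
    · intro y _
      obtain ⟨V, hV, h⟩ := hΓ y
      exact ⟨V, mem_nhdsWithin_of_mem_nhds hV, h⟩
  have hbdd : ∀ f : C_c(Y, ℝ≥0), ∃ M : ℝ≥0∞, M ≠ ∞ ∧
      ∀ᶠ n in atTop, ∫⁻ y, f y ∂Γ n ≤ M := by
    intro f
    obtain ⟨M, hM, h⟩ := hK (tsupport f) f.hasCompactSupport
    obtain ⟨B, hB⟩ := f.continuous.bddAbove_range_of_hasCompactSupport f.hasCompactSupport
    refine ⟨B * M, ENNReal.mul_ne_top ENNReal.coe_ne_top hM, h.mono fun n hn => ?_⟩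
    calc ∫⁻ y, f y ∂Γ n ≤ ∫⁻ y, (tsupport f).indicator (fun _ => (B : ℝ≥0∞)) y ∂Γ n := by
          refine lintegral_mono fun y => ?_
          by_cases hy : y ∈ tsupport f
          · simpa [hy] using hB ⟨y, rfl⟩
          · simp [hy, image_eq_zero_of_notMem_tsupport hy]
      _ = B * Γ n (tsupport f) := lintegral_indicator_const (isClosed_tsupport f).measurableSet _
      _ ≤ B * M := by gcongr
  choose M hM hMle using hbdd
  let L : C_c(Y, ℝ≥0) → ℝ≥0∞ := fun f => (U.map fun n => ∫⁻ y, f y ∂Γ n).lim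
  have hL : ∀ f : C_c(Y, ℝ≥0), Tendsto (fun n => ∫⁻ y, f y ∂Γ n) U (𝓝 (L f)) := fun f =>
    (U.map fun n => ∫⁻ y, f y ∂Γ n).le_nhds_lim
  have hLfin : ∀ f, L f ≠ ∞ := fun f =>
    ne_top_of_le_ne_top (hM f) (le_of_tendsto (hL f) (hU (hMle f)))
  let Λ : C_c(Y, ℝ≥0) →ₗ[ℝ≥0] ℝ≥0 :=
    { toFun := fun f => (L f).toNNReal
      map_add' := by
        intro f g
        rw [← ENNReal.toNNReal_add (hLfin f) (hLfin g)]
        congr 1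
        refine tendsto_nhds_unique (hL (f + g)) (((hL f).add (hL g)).congr fun n => ?_)
        rw [← lintegral_add_left (by fun_prop)]
        rfl
      map_smul' := by
        intro r f
        rw [RingHom.id_apply, smul_eq_mul, ← ENNReal.toNNReal_coe r, ← ENNReal.toNNReal_mul,
          ENNReal.toNNReal_coe]
        congr 1
        refine tendsto_nhds_unique (hL (r • f))
          ((ENNReal.Tendsto.const_mul (hL f) (Or.inr ENNReal.coe_ne_top)).congr fun n => ?_)
        rw [← lintegral_const_mul _ (by fun_prop)]
        refine lintegral_congr fun y => ?_
        simp }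
  refine ⟨NNRealRMK.rieszMeasure Λ, U, inferInstance, hU, fun f => ?_⟩
  rw [NNRealRMK.lintegral_rieszMeasure]
  change Tendsto _ _ (𝓝 ((L f).toNNReal : ℝ≥0∞))
  rw [ENNReal.coe_toNNReal (hLfin f)]
  exact hL f

/-- Measures which agree on the continuous functions with compact support in the open set `Aᶜ`
coincide on this set. -/
theorem restrict_eq_of_lintegral_eq {X : Type*} [MetricSpace X] [ProperSpace X]
    [MeasurableSpace X] [BorelSpace X] {A : Set X} (hA : IsClosed A) {α β : Measure X}
    (hβ : ∀ K, IsCompact K → K ⊆ Aᶜ → β K ≠ ∞)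
    (h : ∀ φ : X → ℝ≥0, Continuous φ → HasCompactSupport φ → tsupport φ ⊆ Aᶜ →
      ∫⁻ x, φ x ∂α = ∫⁻ x, φ x ∂β) :
    α.restrict Aᶜ = β.restrict Aᶜ := by
  have hO : IsOpen Aᶜ := hA.isOpen_compl
  have : LocallyCompactSpace (Aᶜ : Set X) := hO.locallyCompactSpace
  have hfin : ∀ ρ : Measure X, (∀ K, IsCompact K → K ⊆ Aᶜ → ρ K ≠ ∞) →
      (ρ.comap (Subtype.val : (Aᶜ : Set X) → X)).Regular := by
    intro ρ hρ
    have : IsFiniteMeasureOnCompacts (ρ.comap (Subtype.val : (Aᶜ : Set X) → X)) := by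
      refine ⟨fun K hK => ?_⟩
      rw [comap_subtype_coe_apply hO.measurableSet]
      exact (hρ _ (hK.image continuous_subtype_val) (Subtype.coe_image_subset _ _)).lt_top
    infer_instance
  -- Local finiteness passes from `β` to `α` by testing on a Urysohn function that is `1` on `K` and
  -- supported in `Aᶜ`.
  have hα : ∀ K, IsCompact K → K ⊆ Aᶜ → α K ≠ ∞ := by
    intro K hK hKA
    obtain ⟨f, hf1, hfc, hfA, hf⟩ := exists_continuousMap_one_of_isCompact_subset_isOpen hK hO hKA
    let φ : X → ℝ≥0 := fun x => (f x).toNNReal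
    have hφ : Continuous φ := by fun_prop
    have hsupp : tsupport φ ⊆ tsupport f := by
      refine closure_mono fun x hx hx' => hx ?_
      simp [φ, hx']
    have hφc : HasCompactSupport φ := hfc.of_isClosed_subset (isClosed_tsupport _) hsupp
    have h1 : α K ≤ ∫⁻ x, φ x ∂α := by
      rw [← lintegral_indicator_one hK.measurableSet]
      refine lintegral_mono fun x => ?_
      by_cases hx : x ∈ K
      · simp [hx, φ, hf1 hx]
      · simp [hx]
    refine ne_top_of_le_ne_top ?_ h1
    rw [h φ hφ hφc (hsupp.trans hfA)]
    have h2 : ∫⁻ x, φ x ∂β ≤ β (tsupport f) := by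
      rw [← lintegral_indicator_one (isClosed_tsupport f).measurableSet]
      refine lintegral_mono fun x => ?_
      by_cases hx : x ∈ tsupport f
      · simp only [hx, Set.indicator_of_mem, Pi.one_apply]
        exact_mod_cast Real.toNNReal_le_one.2 (hf x).2
      · simp [hx, φ, image_eq_zero_of_notMem_tsupport hx]
    exact ne_top_of_le_ne_top (hβ _ hfc hfA) h2
  have := hfin α hα
  have := hfin β hβ
  have key : α.comap (Subtype.val : (Aᶜ : Set X) → X) = β.comap Subtype.val := by
    refine Measure.ext_of_integral_eq_on_compactlySupported_nnreal fun f => ?_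
    have hcl : ∀ ρ : Measure X, ∫ x, (f x : ℝ) ∂(ρ.comap (Subtype.val : (Aᶜ : Set X) → X)) =
        (∫⁻ x, (Subtype.val.extend f 0 x : ℝ≥0) ∂ρ).toReal := by
      intro ρ
      have hfc : Continuous fun x => ((f x : ℝ≥0) : ℝ) := NNReal.continuous_coe.comp f.continuous
      rw [integral_eq_lintegral_of_nonneg_ae (ae_of_all _ fun x => NNReal.coe_nonneg (f x))
        hfc.aestronglyMeasurable]
      congr 1
      have h1 : ∀ x : (Aᶜ : Set X), ENNReal.ofReal (f x) = (Subtype.val.extend f 0 (x : X) : ℝ≥0) := by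
        intro x
        rw [Subtype.val_injective.extend_apply, ENNReal.ofReal_coe_nnreal]
      rw [lintegral_congr h1, lintegral_subtype_comap hO.measurableSet
        (fun x => ((Subtype.val.extend f 0 x : ℝ≥0) : ℝ≥0∞))]
      rw [← lintegral_indicator hO.measurableSet]
      congr 1
      refine Set.indicator_eq_self.2 fun x hx => ?_
      by_contra hxA
      refine hx ?_
      simp only [ENNReal.coe_eq_zero]
      refine Function.extend_apply' _ _ _ ?_
      rintro ⟨y, rfl⟩
      exact hxA y.2
    rw [hcl, hcl, h]
    · exact f.hasCompactSupport.continuous_extend_zero hO f.continuous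
    · exact f.hasCompactSupport.extend_zero continuous_subtype_val
    · refine (f.hasCompactSupport.tsupport_extend_zero_subset continuous_subtype_val).trans ?_
      exact Subtype.coe_image_subset _ _
  rw [← map_comap_subtype_coe hO.measurableSet, key, map_comap_subtype_coe hO.measurableSet]

/-- A continuous cutoff, equal to `1` on `[0, R]` and to `0` on `[2R, ∞)`. -/
noncomputable def cutoff (R x : ℝ≥0) : ℝ≥0 := min 1 (2 - x / R)

theorem continuous_cutoff (R : ℝ≥0) : Continuous (cutoff R) := by
  unfold cutoff
  fun_prop

theorem cutoff_le_one (R x : ℝ≥0) : cutoff R x ≤ 1 := min_le_left _ _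

theorem cutoff_eq_one {R x : ℝ≥0} (h : x ≤ R) : cutoff R x = 1 := by
  refine min_eq_left (le_tsub_of_add_le_right ?_)
  have : x / R ≤ 1 := div_le_one_of_le₀ h zero_le
  calc 1 + x / R ≤ 1 + 1 := by gcongr
    _ = 2 := by norm_num

theorem cutoff_eq_zero {R x : ℝ≥0} (hR : 0 < R) (h : 2 * R ≤ x) : cutoff R x = 0 := by
  have : 2 ≤ x / R := (le_div_iff₀ hR).2 h
  simp [cutoff, tsub_eq_zero_of_le this]

theorem cutoff_mono {R R' : ℝ≥0} (hR : 0 < R) (h : R ≤ R') (x : ℝ≥0) :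
    cutoff R x ≤ cutoff R' x := by
  unfold cutoff
  gcongr

/-- A Markov-type bound: the mass removed by cutting off at cost `R` is at most the cost divided by
`R`. -/
theorem one_le_cutoff_add {R : ℝ≥0} (hR : 0 < R) (x : ℝ≥0) : 1 ≤ cutoff R x + x / R := by
  rcases le_total x R with h | h
  · rw [cutoff_eq_one h]
    exact le_self_add
  · exact ((one_le_div hR).2 h).trans le_add_self

open scoped CompactlySupported in
/-- Compactness: a sequence of measures on `W` whose marginals on `Ω` stabilise and whose costs
converge has a limit with the limiting marginals, and with at most the limiting cost. -/
theorem exists_limit_of_marginals {W X I : Type*} [MetricSpace W] [ProperSpace W]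
    [MeasurableSpace W] [BorelSpace W] [MetricSpace X] [ProperSpace X] [MeasurableSpace X]
    [BorelSpace X] {A : Set X} (hA : IsClosed A) {e : I → W → X} (he : ∀ i, Continuous (e i))
    {c : W → ℝ≥0} (hc : Continuous c)
    (hcpt : ∀ i K R, IsCompact K → IsCompact {w | e i w ∈ K ∧ c w ≤ R})
    (m : I → Measure X) (hm : ∀ i K, IsCompact K → K ⊆ Aᶜ → m i K ≠ ∞)
    (Γ : ℕ → Measure W)
    (hΓ : ∀ i, ∀ᶠ n in atTop, ((Γ n).map (e i)).restrict Aᶜ = (m i).restrict Aᶜ)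
    (C : ℕ → ℝ≥0∞) (C' : ℝ≥0∞) (hC' : C' ≠ ∞) (hC : Tendsto C atTop (𝓝 C'))
    (hle : ∀ n, ∫⁻ w, c w ∂Γ n ≤ C n) :
    ∃ G : Measure W, (∀ i, (G.map (e i)).restrict Aᶜ = (m i).restrict Aᶜ) ∧
      ∫⁻ w, c w ∂G ≤ C' := by
  have hO : IsOpen Aᶜ := hA.isOpen_compl
  -- Mass is locally bounded only here: near such a point some `e i` takes values in a compact
  -- subset of `Ω`, whose mass is eventually given by `m i`. Points with every `e i` in `A` are
  -- irrelevant to the marginals on `Ω` and are dropped.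
  set Y : Set W := ⋃ i, e i ⁻¹' Aᶜ with hY
  have hYo : IsOpen Y := isOpen_iUnion fun i => hO.preimage (he i)
  have : LocallyCompactSpace Y := hYo.locallyCompactSpace
  set Γ' : ℕ → Measure Y := fun n => (Γ n).comap Subtype.val with hΓ'
  have hval : ∀ n (f : W → ℝ≥0∞), ∫⁻ y : Y, f y ∂Γ' n = ∫⁻ w in Y, f w ∂Γ n := fun n f =>
    lintegral_subtype_comap hYo.measurableSet f
  obtain ⟨G, U, hG, hU, hGU⟩ := exists_vague_limit Γ' (by
    rintro ⟨y, hy⟩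
    obtain ⟨i, hi⟩ := Set.mem_iUnion.1 hy
    obtain ⟨K, hK, hKA, hKn⟩ : ∃ K, IsCompact K ∧ K ⊆ Aᶜ ∧ K ∈ 𝓝 (e i y) := by
      obtain ⟨K, hK, hKn, hKA⟩ := exists_compact_subset hO hi
      exact ⟨K, hK, hKA, mem_interior_iff_mem_nhds.1 hKn⟩
    refine ⟨(fun z : Y => e i z) ⁻¹' K,
      ((he i).comp continuous_subtype_val).continuousAt.preimage_mem_nhds hKn,
      m i K, hm i K hK hKA, (hΓ i).mono fun n hn => ?_⟩
    rw [hΓ', comap_subtype_coe_apply hYo.measurableSet]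
    calc Γ n (Subtype.val '' ((fun z : Y => e i z) ⁻¹' K)) ≤ Γ n (e i ⁻¹' K) := by
          refine measure_mono ?_
          rintro _ ⟨z, hz, rfl⟩
          exact hz
      _ = ((Γ n).map (e i)).restrict Aᶜ K := by
          rw [Measure.restrict_apply hK.measurableSet, Set.inter_eq_left.2 hKA,
            Measure.map_apply (he i).measurable hK.measurableSet]
      _ = m i K := by
          rw [hn, Measure.restrict_apply hK.measurableSet, Set.inter_eq_left.2 hKA])
  have hGint : ∀ f : W → ℝ≥0∞, ∫⁻ w, f w ∂(G.map Subtype.val) = ∫⁻ y : Y, f y ∂G := fun f =>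
    (MeasurableEmbedding.subtype_coe hYo.measurableSet).lintegral_map f
  refine ⟨G.map Subtype.val, fun i => ?_, ?_⟩
  · refine restrict_eq_of_lintegral_eq hA (hm i) fun φ hφ hφc hφA => ?_
    have hφ' : Measurable fun x => (φ x : ℝ≥0∞) := hφ.measurable.coe_nnreal_ennreal
    have hφ0 : ∀ x, x ∉ tsupport φ → φ x = 0 := fun x => image_eq_zero_of_notMem_tsupport
    obtain ⟨B, hB⟩ := hφ.bddAbove_range_of_hasCompactSupport hφc
    set M := ∫⁻ x, φ x ∂(m i) with hM
    have hrestr : ∀ ρ : Measure X, ∫⁻ x, φ x ∂(ρ.restrict Aᶜ) = ∫⁻ x, φ x ∂ρ := by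
      intro ρ
      rw [← lintegral_indicator hO.measurableSet]
      congr 1
      refine Set.indicator_eq_self.2 fun x hx => ?_
      by_contra hxA
      exact hx (by simp [hφ0 x fun h => hxA (hφA h)])
    have hΓM : ∀ᶠ n in atTop, ∫⁻ w, φ (e i w) ∂Γ n = M := by
      refine (hΓ i).mono fun n hn => ?_
      rw [hM, ← hrestr, ← hn, hrestr, lintegral_map hφ' (he i).measurable]
    let θ : ℕ → ℝ≥0 → ℝ≥0 := fun k => cutoff (k + 1)
    have hkpos : ∀ k : ℕ, (0 : ℝ≥0) < k + 1 := fun k => by positivity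
    let f : ℕ → W → ℝ≥0 := fun k w => φ (e i w) * θ k (c w)
    have hf : ∀ k, Continuous (f k) := fun k =>
      (hφ.comp (he i)).mul ((continuous_cutoff _).comp hc)
    have hf0 : ∀ (k : ℕ) w, w ∉ {w | e i w ∈ tsupport φ ∧ c w ≤ 2 * ((k : ℝ≥0) + 1)} →
        f k w = 0 := by
      intro k w hw
      by_cases h1 : e i w ∈ tsupport φ
      · have h2 : 2 * ((k : ℝ≥0) + 1) ≤ c w := (not_le.1 fun h2 => hw ⟨h1, h2⟩).le
        simp [f, θ, cutoff_eq_zero (hkpos k) h2]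
      · simp [f, hφ0 _ h1]
    have hSY : ∀ k : ℕ, {w | e i w ∈ tsupport φ ∧ c w ≤ 2 * ((k : ℝ≥0) + 1)} ⊆ Y := fun k w hw =>
      Set.mem_iUnion.2 ⟨i, hφA hw.1⟩
    have hSc : ∀ k : ℕ, IsCompact {y : Y | e i y ∈ tsupport φ ∧ c y ≤ 2 * ((k : ℝ≥0) + 1)} := by
      intro k
      rw [Subtype.isCompact_iff]
      convert hcpt i _ (2 * ((k : ℝ≥0) + 1)) hφc using 1
      ext w
      constructor
      · rintro ⟨y, hy, rfl⟩
        exact hy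
      · exact fun hw => ⟨⟨w, hSY k hw⟩, hw, rfl⟩
    let F : ℕ → C_c(Y, ℝ≥0) := fun k =>
      { toFun := fun y => f k y
        continuous_toFun := (hf k).comp continuous_subtype_val
        hasCompactSupport' := HasCompactSupport.intro (hSc k) fun y hy => hf0 k y hy }
    have hFn : ∀ k n, ∫⁻ y, F k y ∂Γ' n = ∫⁻ w, f k w ∂Γ n := by
      intro k n
      change ∫⁻ y : Y, f k y ∂Γ' n = _
      rw [hval n fun w => (f k w : ℝ≥0∞), ← lintegral_indicator hYo.measurableSet]
      congr 1
      refine Set.indicator_eq_self.2 fun w hw => ?_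
      by_contra hwY
      exact hw (by simp [hf0 k w fun h => hwY (hSY k h)])
    have hup : ∀ k, ∫⁻ y, F k y ∂G ≤ M := by
      intro k
      refine le_of_tendsto (hGU (F k)) (hU (hΓM.mono fun n hn => ?_))
      rw [hFn, ← hn]
      refine lintegral_mono fun w => ?_
      exact ENNReal.coe_le_coe.2 (mul_le_of_le_one_right zero_le (cutoff_le_one _ _))
    -- The function `φ ∘ e i` need not have compact support, so mass could escape to infinity. The
    -- cost bound makes the loss at level `k` at most `B / (k + 1)` times the cost, uniformly in
    -- `n`.
    have hlow : ∀ k : ℕ, M ≤ ∫⁻ y, F k y ∂G + B / (k + 1 : ℝ≥0) * C' := by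
      intro k
      have hfin : ((B / (k + 1 : ℝ≥0) : ℝ≥0) : ℝ≥0∞) ≠ ∞ := ENNReal.coe_ne_top
      have hlim : Tendsto (fun n => ∫⁻ y, F k y ∂Γ' n + (B / (k + 1 : ℝ≥0) : ℝ≥0) * C n) U
          (𝓝 (∫⁻ y, F k y ∂G + (B / (k + 1 : ℝ≥0) : ℝ≥0) * C')) :=
        (hGU (F k)).add (ENNReal.Tendsto.const_mul (hC.mono_left hU) (Or.inr hfin))
      rw [← ENNReal.coe_div (hkpos k).ne']
      refine ge_of_tendsto hlim (hU (hΓM.mono fun n hn => ?_))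
      rw [hFn, ← hn]
      calc ∫⁻ w, φ (e i w) ∂Γ n
          ≤ ∫⁻ w, (f k w + (B / (k + 1 : ℝ≥0) : ℝ≥0) * c w) ∂Γ n := by
            refine lintegral_mono fun w => ?_
            have h1 := one_le_cutoff_add (hkpos k) (c w)
            have h2 : φ (e i w) ≤ f k w + B / (k + 1) * c w := by
              calc φ (e i w) ≤ φ (e i w) * (θ k (c w) + c w / (k + 1)) :=
                    le_mul_of_one_le_right zero_le h1
                _ = f k w + φ (e i w) * (c w / (k + 1)) := mul_add _ _ _
                _ ≤ f k w + B * (c w / (k + 1)) := by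
                    gcongr
                    exact hB ⟨_, rfl⟩
                _ = f k w + B / (k + 1) * c w := by ring
            rw [← ENNReal.coe_mul, ← ENNReal.coe_add]
            exact ENNReal.coe_le_coe.2 h2
        _ = ∫⁻ w, f k w ∂Γ n + (B / (k + 1 : ℝ≥0) : ℝ≥0) * ∫⁻ w, c w ∂Γ n := by
            rw [lintegral_add_left (hf k).measurable.coe_nnreal_ennreal,
              lintegral_const_mul _ hc.measurable.coe_nnreal_ennreal]
        _ ≤ _ := by
            gcongr
            exact hle n
    rw [lintegral_map hφ' (he i).measurable, hGint fun w => (φ (e i w) : ℝ≥0∞)]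
    have hmono : Tendsto (fun k => ∫⁻ y, F k y ∂G) atTop (𝓝 (∫⁻ y : Y, φ (e i y) ∂G)) := by
      refine lintegral_tendsto_of_tendsto_of_monotone
        (fun k => (F k).continuous.measurable.coe_nnreal_ennreal.aemeasurable)
        (ae_of_all _ fun y => ?_) (ae_of_all _ fun y => ?_)
      · intro k l hkl
        change (f k y : ℝ≥0∞) ≤ f l y
        have : θ k (c y) ≤ θ l (c y) := by
          refine cutoff_mono (hkpos k) ?_ _
          gcongr
        exact_mod_cast mul_le_mul_right this _
      · obtain ⟨k₀, hk₀⟩ := exists_nat_ge (c y)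
        refine tendsto_const_nhds.congr' (eventually_atTop.2 ⟨k₀, fun k hk => ?_⟩)
        change (φ (e i y) : ℝ≥0∞) = (f k y : ℝ≥0)
        have : c y ≤ k + 1 := hk₀.trans ((Nat.cast_le.2 hk).trans le_self_add)
        simp [f, θ, cutoff_eq_one this]
    refine le_antisymm (le_of_tendsto' hmono hup) ?_
    have hzero : Tendsto (fun k : ℕ => (B : ℝ≥0∞) / (k + 1 : ℝ≥0) * C') atTop (𝓝 0) := by
      have h1 : Tendsto (fun k : ℕ => B / ((k : ℝ≥0) + 1)) atTop (𝓝 0) := by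
        have := (tendsto_const_div_atTop_nhds_zero_nat B).comp (tendsto_add_atTop_nat 1)
        simpa [Function.comp_def] using this
      have h2 := ENNReal.Tendsto.mul_const (b := C') (ENNReal.tendsto_coe.2 h1) (Or.inr hC')
      rw [ENNReal.coe_zero, zero_mul] at h2
      refine h2.congr fun k => ?_
      rw [ENNReal.coe_div (hkpos k).ne']
    have := hmono.add hzero
    rw [add_zero] at this
    exact ge_of_tendsto' this hlow
  · rw [hGint fun w => (c w : ℝ≥0∞)]
    -- Lower semicontinuity of the cost: vague convergence applies to `c` times compactly supported
    -- cutoffs, and Fatou removes the cutoffs.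
    let E : CompactExhaustion Y := default
    have hχ : ∀ k, ∃ f : C(Y, ℝ), Set.EqOn f 1 (E k) ∧ IsCompact (tsupport f) ∧
        tsupport f ⊆ Set.univ ∧ ∀ x, f x ∈ Set.Icc (0 : ℝ) 1 := fun k =>
      exists_continuousMap_one_of_isCompact_subset_isOpen (E.isCompact k) isOpen_univ
        (Set.subset_univ _)
    choose χ hχ1 hχc _ hχ01 using hχ
    let F : ℕ → C_c(Y, ℝ≥0) := fun k =>
      { toFun := fun y => (χ k y).toNNReal * c y
        continuous_toFun := by fun_prop
        hasCompactSupport' := HasCompactSupport.intro (hχc k) fun y hy => by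
          simp [image_eq_zero_of_notMem_tsupport hy] }
    have hF : ∀ k, ∫⁻ y, F k y ∂G ≤ C' := by
      intro k
      refine le_of_tendsto_of_tendsto' (hGU (F k)) (hC.mono_left hU) fun n => ?_
      calc ∫⁻ y, F k y ∂Γ' n ≤ ∫⁻ y : Y, c y ∂Γ' n := by
            refine lintegral_mono fun y => ?_
            change (((χ k y).toNNReal * c y : ℝ≥0) : ℝ≥0∞) ≤ c y
            exact_mod_cast mul_le_of_le_one_left zero_le (Real.toNNReal_le_one.2 (hχ01 k y).2)
        _ = ∫⁻ w in Y, c w ∂Γ n := hval n fun w => (c w : ℝ≥0∞)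
        _ ≤ ∫⁻ w, c w ∂Γ n := setLIntegral_le_lintegral _ _
        _ ≤ C n := hle n
    calc ∫⁻ y : Y, c y ∂G = ∫⁻ y : Y, liminf (fun k => (F k y : ℝ≥0∞)) atTop ∂G := by
          refine lintegral_congr fun y => ?_
          obtain ⟨k₀, hk₀⟩ := E.exists_mem y
          refine (Tendsto.liminf_eq (tendsto_const_nhds.congr'
            (eventually_atTop.2 ⟨k₀, fun k hk => ?_⟩))).symm
          change (c y : ℝ≥0∞) = ((χ k y).toNNReal * c y : ℝ≥0)
          simp [hχ1 k (E.subset hk hk₀)]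
      _ ≤ liminf (fun k => ∫⁻ y, F k y ∂G) atTop :=
          lintegral_liminf_le fun k => (F k).continuous.measurable.coe_nnreal_ennreal
      _ ≤ liminf (fun _ : ℕ => C') atTop := liminf_le_liminf (Eventually.of_forall hF)
      _ = C' := by simp

/-! ### Partial plans as measures on `X × X` -/

theorem restrictTo_eq_iff {Z : Type*} [MeasurableSpace Z] {S : Set Z} (hS : MeasurableSet S)
    (ν : Measure Z) (μ : Measure S) :
    restrictTo S ν = μ ↔ ν.restrict S = μ.map Subtype.val := by
  constructor
  · rintro rfl
    exact (map_comap_subtype_coe hS ν).symm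
  · intro h
    rw [← map_comap_subtype_coe hS] at h
    exact (MeasurableEmbedding.subtype_coe hS).map_injective h

/-- A measure on `X × X` whose marginals restricted to `Ω` are `μ` and `ν`. -/
structure IsPlan {X : Type*} [MeasurableSpace X] (A : Set X) (μ ν : Measure (Omega A))
    (Γ : Measure (X × X)) : Prop where
  fst : (Γ.map Prod.fst).restrict Aᶜ = μ.map Subtype.val
  snd : (Γ.map Prod.snd).restrict Aᶜ = ν.map Subtype.val

section Plans

variable {X : Type*} [MeasurableSpace X] {A : Set X} {p : ℝ}

theorem restrict_map_val (hA : MeasurableSet A) (ρ : Measure (Omega A)) :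
    (ρ.map Subtype.val).restrict Aᶜ = ρ.map Subtype.val := by
  rw [← restrictTo_eq_iff hA.compl]
  exact (MeasurableEmbedding.subtype_coe hA.compl).comap_map ρ

theorem map_restrictTo_restrict {Z : Type*} [MeasurableSpace Z] (hA : MeasurableSet A) {E : Set Z}
    (hE : MeasurableSet E) {f : Z → X} (hf : Measurable f) (hEf : f ⁻¹' Aᶜ ⊆ E) (Γ : Measure Z) :
    ((restrictTo E Γ).map fun z : E => f z).restrict Aᶜ = (Γ.map f).restrict Aᶜ := by
  change ((restrictTo E Γ).map (f ∘ Subtype.val)).restrict Aᶜ = _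
  rw [← Measure.map_map hf measurable_subtype_coe, restrictTo, map_comap_subtype_coe hE,
    Measure.restrict_map hf hA.compl, Measure.restrict_map hf hA.compl,
    Measure.restrict_restrict (hf hA.compl), Set.inter_eq_left.2 hEf]

theorem IsPlan.restrictTo_mem_Adm (hA : MeasurableSet A) {μ ν : Measure (Omega A)}
    {Γ : Measure (X × X)} (h : IsPlan A μ ν Γ) : restrictTo (EOmega A) Γ ∈ Adm A μ ν := by
  have hE : MeasurableSet (EOmega A) := (hA.prod hA).compl
  constructor
  · rw [restrictTo_eq_iff hA.compl]
    refine (map_restrictTo_restrict hA hE measurable_fst ?_ Γ).trans h.fst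
    exact fun z hz hz' => hz hz'.1
  · rw [restrictTo_eq_iff hA.compl]
    refine (map_restrictTo_restrict hA hE measurable_snd ?_ Γ).trans h.snd
    exact fun z hz hz' => hz hz'.2

theorem isPlan_map_of_mem_Adm (hA : MeasurableSet A) {μ ν : Measure (Omega A)}
    {γ : Measure (EOmega A)} (h : γ ∈ Adm A μ ν) : IsPlan A μ ν (γ.map Subtype.val) := by
  constructor
  · rw [Measure.map_map measurable_fst measurable_subtype_coe]
    exact (restrictTo_eq_iff hA.compl _ _).1 h.1
  · rw [Measure.map_map measurable_snd measurable_subtype_coe]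
    exact (restrictTo_eq_iff hA.compl _ _).1 h.2

theorem isPlan_map_prodMk {Z : Type*} [MeasurableSpace Z] {σ : Measure Z} {f g : Z → X}
    (hf : Measurable f) (hg : Measurable g) {μ ν : Measure (Omega A)}
    (hμ : (σ.map f).restrict Aᶜ = μ.map Subtype.val)
    (hν : (σ.map g).restrict Aᶜ = ν.map Subtype.val) :
    IsPlan A μ ν (σ.map fun z => (f z, g z)) := by
  constructor
  · rwa [Measure.map_map measurable_fst (hf.prodMk hg)]
  · rwa [Measure.map_map measurable_snd (hf.prodMk hg)]

variable [MetricSpace X]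

theorem cost_restrictTo_le (hA : MeasurableSet A) (Γ : Measure (X × X)) :
    cost A p (restrictTo (EOmega A) Γ) ≤ ∫⁻ z, edist z.1 z.2 ^ p ∂Γ := by
  have hE : MeasurableSet (EOmega A) := (hA.prod hA).compl
  rw [cost, restrictTo, lintegral_subtype_comap hE fun z : X × X => edist z.1 z.2 ^ p]
  exact setLIntegral_le_lintegral _ _

theorem Wb_le_of_mem_Adm {μ ν : Measure (Omega A)} {γ : Measure (EOmega A)} (h : γ ∈ Adm A μ ν) :
    Wb A p μ ν ≤ cost A p γ ^ (1 / p) :=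
  iInf₂_le γ h

theorem IsPlan.Wb_le (hA : MeasurableSet A) (hp : 1 ≤ p) {μ ν : Measure (Omega A)}
    {Γ : Measure (X × X)} (h : IsPlan A μ ν Γ) :
    Wb A p μ ν ≤ (∫⁻ z, edist z.1 z.2 ^ p ∂Γ) ^ (1 / p) :=
  (Wb_le_of_mem_Adm (h.restrictTo_mem_Adm hA)).trans
    (ENNReal.rpow_le_rpow (cost_restrictTo_le hA Γ) (by positivity))

theorem IsPlan.Wb_rpow_le (hA : MeasurableSet A) (hp : 1 ≤ p) {μ ν : Measure (Omega A)}
    {Γ : Measure (X × X)} (h : IsPlan A μ ν Γ) :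
    Wb A p μ ν ^ p ≤ ∫⁻ z, edist z.1 z.2 ^ p ∂Γ := by
  have hp0 : 0 < p := by linarith
  have := ENNReal.rpow_le_rpow (h.Wb_le hA hp) hp0.le
  rwa [← ENNReal.rpow_mul, one_div_mul_cancel hp0.ne', ENNReal.rpow_one] at this

theorem IsPlan.restrictTo_mem_Opt (hA : MeasurableSet A) (hp : 1 ≤ p) {μ ν : Measure (Omega A)}
    {Γ : Measure (X × X)} (h : IsPlan A μ ν Γ)
    (hle : ∫⁻ z, edist z.1 z.2 ^ p ∂Γ ≤ Wb A p μ ν ^ p) :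
    restrictTo (EOmega A) Γ ∈ Opt A p μ ν := by
  have hp0 : 0 < p := by linarith
  refine ⟨h.restrictTo_mem_Adm hA, le_antisymm ((cost_restrictTo_le hA Γ).trans hle) ?_⟩
  have := ENNReal.rpow_le_rpow (Wb_le_of_mem_Adm (p := p) (h.restrictTo_mem_Adm hA)) hp0.le
  rwa [← ENNReal.rpow_mul, one_div_mul_cancel hp0.ne', ENNReal.rpow_one] at this

theorem lintegral_map_val_eq_cost (hA : MeasurableSet A) (γ : Measure (EOmega A)) :
    ∫⁻ z, edist z.1 z.2 ^ p ∂(γ.map Subtype.val) = cost A p γ :=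
  (MeasurableEmbedding.subtype_coe (hA.prod hA).compl).lintegral_map _

theorem Mp.isFiniteMeasureOnCompacts (μ : Mp A p) : IsFiniteMeasureOnCompacts μ.1 := μ.2.1.1

theorem Mp.map_val_ne_top [BorelSpace X] (μ : Mp A p) {K : Set X}
    (hK : IsCompact K) (hKA : K ⊆ Aᶜ) : μ.1.map Subtype.val K ≠ ∞ := by
  have := μ.isFiniteMeasureOnCompacts
  rw [Measure.map_apply measurable_subtype_coe hK.measurableSet]
  refine (IsCompact.measure_lt_top ?_).ne
  rw [Subtype.isCompact_iff, Subtype.image_preimage_coe, Set.inter_eq_right.2 hKA]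
  exact hK

theorem Mp.sigmaFinite [ProperSpace X] [BorelSpace X] (hA : IsClosed A) (μ : Mp A p) :
    SigmaFinite (μ.1.map Subtype.val) := by
  have := μ.isFiniteMeasureOnCompacts
  have : LocallyCompactSpace (Omega A) := hA.isOpen_compl.locallyCompactSpace
  have : SigmaFinite μ.1 := inferInstance
  exact (MeasurableEmbedding.subtype_coe hA.isOpen_compl.measurableSet).sigmaFinite_map

theorem Wb_ne_top [ProperSpace X] [BorelSpace X] (hA : IsClosed A) (hne : A.Nonempty)
    (hp : 1 ≤ p) (μ ν : Mp A p) : Wb A p μ.1 ν.1 ≠ ∞ :=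
  (Wb_lt_top A hA hne p hp μ ν).ne

/-- The direct method: almost optimal plans have fixed marginals and convergent costs. Compactness
holds because, in a proper space, pairs with one point in a compact set and bounded displacement
form a compact set. -/
theorem exists_optimal_plan [ProperSpace X] [BorelSpace X] (hA : IsClosed A) (hne : A.Nonempty)
    (hp : 1 ≤ p) (μ ν : Mp A p) :
    ∃ Γ, IsPlan A μ.1 ν.1 Γ ∧ ∫⁻ z, edist z.1 z.2 ^ p ∂Γ = Wb A p μ.1 ν.1 ^ p := by
  have hp0 : 0 < p := by linarith
  have hAm := hA.measurableSet
  set w := Wb A p μ.1 ν.1 with hw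
  have hwtop : w ≠ ∞ := Wb_ne_top hA hne hp μ ν
  have hex : ∀ n : ℕ, ∃ γ ∈ Adm A μ.1 ν.1, cost A p γ ≤ (w + ((n : ℝ≥0∞) + 1)⁻¹) ^ p := by
    intro n
    have hlt : w < w + ((n : ℝ≥0∞) + 1)⁻¹ :=
      ENNReal.lt_add_right hwtop (by simp)
    rw [hw, Wb] at hlt
    simp only [iInf_lt_iff] at hlt
    obtain ⟨γ, hγ, hlt⟩ := hlt
    refine ⟨γ, hγ, ?_⟩
    have := ENNReal.rpow_le_rpow hlt.le hp0.le
    rwa [← ENNReal.rpow_mul, one_div_mul_cancel hp0.ne', ENNReal.rpow_one] at this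
  choose γ hγ hcost using hex
  let e : Bool → X × X → X := fun b z => if b then z.1 else z.2
  have he : ∀ b, Continuous (e b) := by
    rintro (_ | _)
    · exact continuous_snd
    · exact continuous_fst
  let c : X × X → ℝ≥0 := fun z => nndist z.1 z.2 ^ p
  have hc : Continuous c :=
    (NNReal.continuous_rpow_const hp0.le).comp (continuous_fst.nndist continuous_snd)
  have hcedist : ∀ z : X × X, (c z : ℝ≥0∞) = edist z.1 z.2 ^ p := fun z => by
    rw [edist_nndist, ENNReal.coe_rpow_of_nonneg _ hp0.le]
  obtain ⟨Γ, hΓ, hΓc⟩ := exists_limit_of_marginals hA he hc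
    (by
      intro b K R hK
      set R' : ℝ≥0 := R ^ (1 / p)
      have hK' : IsCompact (Metric.cthickening R' K) := hK.cthickening
      have hcl : IsClosed {z | c z ≤ R} := isClosed_le hc continuous_const
      refine (hK'.prod hK').of_isClosed_subset ((hK.isClosed.preimage (he b)).inter hcl) ?_
      rintro z ⟨hz, hzR⟩
      have hd : nndist z.1 z.2 ≤ R' := by
        have := NNReal.rpow_le_rpow hzR (show 0 ≤ 1 / p by positivity)
        rwa [← NNReal.rpow_mul, mul_one_div_cancel hp0.ne', NNReal.rpow_one] at this
      have hd' : dist z.1 z.2 ≤ R' := hd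
      have hsub : K ⊆ Metric.cthickening R' K := Metric.self_subset_cthickening K
      cases b
      · exact ⟨Metric.mem_cthickening_of_dist_le _ z.2 _ _ hz hd', hsub hz⟩
      · exact ⟨hsub hz, Metric.mem_cthickening_of_dist_le _ z.1 _ _ hz (dist_comm z.1 z.2 ▸ hd')⟩)
    (fun b => if b then μ.1.map Subtype.val else ν.1.map Subtype.val)
    (by
      rintro (_ | _) K hK hKA
      · exact ν.map_val_ne_top hK hKA
      · exact μ.map_val_ne_top hK hKA)
    (fun n => (γ n).map Subtype.val)
    (by
      rintro (_ | _)
      · refine Eventually.of_forall fun n => ?_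
        simp only [Bool.false_eq_true, if_false, restrict_map_val hAm]
        exact (isPlan_map_of_mem_Adm hAm (hγ n)).snd
      · refine Eventually.of_forall fun n => ?_
        simp only [if_true, restrict_map_val hAm]
        exact (isPlan_map_of_mem_Adm hAm (hγ n)).fst)
    (fun n => (w + ((n : ℝ≥0∞) + 1)⁻¹) ^ p) (w ^ p)
    (ENNReal.rpow_ne_top_of_nonneg hp0.le hwtop)
    (by
      refine (ENNReal.continuous_rpow_const.tendsto _).comp ?_
      have h1 : Tendsto (fun n : ℕ => ((n : ℝ≥0∞) + 1)⁻¹) atTop (𝓝 0) := by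
        have := ENNReal.tendsto_inv_nat_nhds_zero.comp (tendsto_add_atTop_nat 1)
        simpa [Function.comp_def] using this
      simpa using h1.const_add w)
    (fun n => by
      simp only [hcedist]
      rw [lintegral_map_val_eq_cost hAm]
      exact hcost n)
  have hplan : IsPlan A μ.1 ν.1 Γ := by
    have h1 := hΓ true
    have h2 := hΓ false
    simp only [Bool.false_eq_true, if_false, if_true, restrict_map_val hAm] at h1 h2
    exact ⟨h1, h2⟩
  refine ⟨Γ, hplan, le_antisymm ?_ (hplan.Wb_rpow_le hAm hp)⟩
  simpa only [hcedist] using hΓc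

end Plans

/-! ### Chains of plans -/

/-- Gluing of finitely many consecutive partial plans. -/
theorem exists_chain {X : Type*} [MeasurableSpace X] [StandardBorelSpace X] [Nonempty X]
    {A : Set X} (hA : MeasurableSet A) (m : ℕ → Measure X) [∀ k, SigmaFinite (m k)]
    (γ : ℕ → Measure (X × X)) (h1 : ∀ k, ((γ k).map Prod.fst).restrict Aᶜ = m k)
    (h2 : ∀ k, ((γ k).map Prod.snd).restrict Aᶜ = m (k + 1))
    {φ : X × X → ℝ≥0∞} (hφ : Measurable φ) (hφ0 : ∀ x, φ (x, x) = 0) (N : ℕ) :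
    ∃ σ : Measure (ℕ → X), (∀ i ≤ N, (σ.map fun z => z i).restrict Aᶜ = m i) ∧
      ∀ i < N, ∫⁻ z, φ (z i, z (i + 1)) ∂σ = ∫⁻ z, φ z ∂γ i := by
  have hc : Measurable fun (x : X) (_ : ℕ) => x := measurable_pi_lambda _ fun _ => measurable_id
  have hev : ∀ i : ℕ, Measurable fun z : ℕ → X => z i := fun i => measurable_pi_apply i
  induction N with
  | zero =>
    refine ⟨(m 0).map fun x _ => x, ?_, by simp⟩
    intro i hi
    rw [Nat.le_zero.1 hi, Measure.map_map (hev 0) hc]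
    change ((m 0).map id).restrict Aᶜ = m 0
    rw [Measure.map_id, ← h1 0, Measure.restrict_restrict hA.compl, Set.inter_self]
  | succ N ih =>
    obtain ⟨σ, hσ, hσφ⟩ := ih
    have hσN := hσ N le_rfl
    -- The mass added by gluing sits on constant sequences or on the diagonal, so it costs nothing
    -- by `hφ0`; it lies over `A`, so the marginals on `Aᶜ` do not see it.
    obtain ⟨τ, a, b, ha, hb, hτ1, hτ2⟩ := exists_glue hA (hev N) hc (fun _ => rfl) σ (γ N)
      (hσN.trans (h1 N).symm) (by rw [hσN]; infer_instance)
    let u : (ℕ → X) × X → ℕ → X := fun q i => if i ≤ N then q.1 i else q.2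
    have hu : Measurable u := by
      refine measurable_pi_lambda _ fun i => ?_
      by_cases hi : i ≤ N
      · simpa [u, hi, Function.comp_def] using (hev i).comp measurable_fst
      · simpa [u, hi] using measurable_snd
    have hmf : Measurable fun q : (ℕ → X) × X => (q.1 N, q.2) :=
      ((hev N).comp measurable_fst).prodMk measurable_snd
    have hd : Measurable fun x : X => (x, x) := measurable_id.prodMk measurable_id
    refine ⟨τ.map u, fun i hi => ?_, fun i hi => ?_⟩
    · rw [Measure.map_map (hev i) hu]
      rcases hi.lt_or_eq with hlt | rfl
      · have hi' : i ≤ N := Nat.lt_succ_iff.1 hlt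
        have heq : ((fun z : ℕ → X => z i) ∘ u) = (fun z : ℕ → X => z i) ∘ Prod.fst := by
          funext q
          simp [u, hi']
        rw [heq, ← Measure.map_map (hev i) measurable_fst, hτ1, Measure.map_add _ _ (hev i),
          Measure.map_map (hev i) hc, Measure.restrict_add, hσ i hi']
        change m i + (a.map id).restrict Aᶜ = m i
        rw [Measure.map_id, Measure.restrict_eq_zero.2 ha, add_zero]
      · have heq : ((fun z : ℕ → X => z (N + 1)) ∘ u) =
            Prod.snd ∘ fun q : (ℕ → X) × X => (q.1 N, q.2) := by
          funext q
          simp [u]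
        rw [heq, ← Measure.map_map measurable_snd hmf, hτ2, Measure.map_add _ _ measurable_snd,
          Measure.map_map measurable_snd hd, Measure.restrict_add, h2]
        change m (N + 1) + (b.map id).restrict Aᶜ = m (N + 1)
        rw [Measure.map_id, Measure.restrict_eq_zero.2 hb, add_zero]
    · have hm : ∀ i, Measurable fun z : ℕ → X => φ (z i, z (i + 1)) := fun i =>
        hφ.comp ((hev i).prodMk (hev (i + 1)))
      rw [lintegral_map (hm i) hu]
      rcases (Nat.lt_succ_iff.1 hi).lt_or_eq with hlt | rfl
      · have heq : ∀ q, φ (u q i, u q (i + 1)) = φ (q.1 i, q.1 (i + 1)) := fun q => by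
          simp [u, hlt.le, Nat.succ_le_of_lt hlt]
        rw [lintegral_congr heq, ← hσφ i hlt, ← lintegral_map (hm i) measurable_fst, hτ1,
          lintegral_add_measure, lintegral_map (hm i) hc]
        simp [hφ0]
      · have heq : ∀ q, φ (u q i, u q (i + 1)) = φ (q.1 i, q.2) := fun q => by
          simp [u]
        rw [lintegral_congr heq, ← lintegral_map (μ := τ) hφ hmf, hτ2, lintegral_add_measure,
          lintegral_map hφ hd]
        simp [hφ0]

section Chains

variable {X : Type*} [MetricSpace X] [ProperSpace X] [MeasurableSpace X] [BorelSpace X]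
  {A : Set X} {p : ℝ}

theorem measurable_edist_rpow (p : ℝ) : Measurable fun z : X × X => edist z.1 z.2 ^ p :=
  (measurable_fst.edist measurable_snd).pow_const p

theorem exists_optimal_chain (hA : IsClosed A) (hne : A.Nonempty) (hp : 1 ≤ p)
    (μ : ℕ → Mp A p) (N : ℕ) :
    ∃ σ : Measure (ℕ → X),
      (∀ i ≤ N, (σ.map fun z => z i).restrict Aᶜ = (μ i).1.map Subtype.val) ∧
      ∀ i < N, ∫⁻ z, edist (z i) (z (i + 1)) ^ p ∂σ = Wb A p (μ i).1 (μ (i + 1)).1 ^ p := by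
  have : Nonempty X := hne.to_type
  choose γ hγ hγc using fun i => exists_optimal_plan hA hne hp (μ i) (μ (i + 1))
  have : ∀ i, SigmaFinite ((μ i).1.map Subtype.val) := fun i => (μ i).sigmaFinite hA
  have hp0 : 0 < p := by linarith
  obtain ⟨σ, hσ, hσc⟩ := exists_chain hA.measurableSet (fun i => (μ i).1.map Subtype.val) γ
    (fun i => (hγ i).fst) (fun i => (hγ i).snd) (measurable_edist_rpow p)
    (fun x => by simp [hp0]) N
  exact ⟨σ, hσ, fun i hi => (hσc i hi).trans (hγc i)⟩

/-- Minkowski's inequality in `L^p` of a glued chain of three points. -/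
theorem Wb_triangle (hA : IsClosed A) (hne : A.Nonempty) (hp : 1 ≤ p) (μ ν ρ : Mp A p) :
    Wb A p μ.1 ρ.1 ≤ Wb A p μ.1 ν.1 + Wb A p ν.1 ρ.1 := by
  have hp0 : 0 < p := by linarith
  obtain ⟨σ, hσ, hσc⟩ := exists_optimal_chain hA hne hp
    (fun i => if i = 0 then μ else if i = 1 then ν else ρ) 2
  have h01 := hσc 0 (by norm_num)
  have h12 := hσc 1 (by norm_num)
  have hm0 := hσ 0 (by norm_num)
  have hm2 := hσ 2 (by norm_num)
  simp at h01 h12 hm0 hm2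
  have hev : ∀ i : ℕ, Measurable fun z : ℕ → X => z i := fun i => measurable_pi_apply i
  have hplan := isPlan_map_prodMk (hev 0) (hev 2) hm0 hm2
  have hroot : ∀ w : ℝ≥0∞, (w ^ p) ^ (1 / p) = w := fun w => by
    rw [← ENNReal.rpow_mul, mul_one_div_cancel hp0.ne', ENNReal.rpow_one]
  calc Wb A p μ.1 ρ.1
      ≤ (∫⁻ z, edist z.1 z.2 ^ p ∂(σ.map fun z => (z 0, z 2))) ^ (1 / p) :=
        hplan.Wb_le hA.measurableSet hp
    _ = (∫⁻ z, edist (z 0) (z 2) ^ p ∂σ) ^ (1 / p) := by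
        rw [lintegral_map (measurable_edist_rpow p) ((hev 0).prodMk (hev 2))]
    _ ≤ (∫⁻ z, ((fun z : ℕ → X => edist (z 0) (z 1)) +
          fun z : ℕ → X => edist (z 1) (z 2)) z ^ p ∂σ)
          ^ (1 / p) := by
        refine ENNReal.rpow_le_rpow (lintegral_mono fun z => ?_) (by positivity)
        exact ENNReal.rpow_le_rpow (edist_triangle _ _ _) hp0.le
    _ ≤ (∫⁻ z, edist (z 0) (z 1) ^ p ∂σ) ^ (1 / p) +
          (∫⁻ z, edist (z 1) (z 2) ^ p ∂σ) ^ (1 / p) :=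
        ENNReal.lintegral_Lp_add_le ((hev 0).edist (hev 1)).aemeasurable
          ((hev 1).edist (hev 2)).aemeasurable hp
    _ = Wb A p μ.1 ν.1 + Wb A p ν.1 ρ.1 := by
        rw [h01, h12, hroot, hroot]

/-- An optimal plan of zero cost is concentrated on the diagonal, so its two marginals coincide. -/
theorem eq_of_Wb_eq_zero (hA : IsClosed A) (hne : A.Nonempty) (hp : 1 ≤ p) (μ ν : Mp A p)
    (h : Wb A p μ.1 ν.1 = 0) : μ.1 = ν.1 := by
  have hp0 : 0 < p := by linarith
  obtain ⟨Γ, hΓ, hΓc⟩ := exists_optimal_plan hA hne hp μ ν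
  rw [h, ENNReal.zero_rpow_of_pos hp0, lintegral_eq_zero_iff (measurable_edist_rpow p)] at hΓc
  have hae : (Prod.fst : X × X → X) =ᵐ[Γ] Prod.snd := by
    refine hΓc.mono fun z hz => ?_
    simpa [hp0, hp0.not_gt] using hz
  refine (MeasurableEmbedding.subtype_coe hA.isOpen_compl.measurableSet).map_injective ?_
  rw [← hΓ.fst, ← hΓ.snd, Measure.map_congr hae]

end Chains

/-! ### The equality case of Jensen's inequality -/

/-- The triangle inequality bounds `D / N` by the mean of the `d i`, and Jensen bounds the power of
the mean. The hypothesis forces equality in both: strict convexity makes the `d i` equal, and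
injectivity of the power identifies their mean. For `p = 1` the hypothesis says only that `D` is the
sum. -/
theorem eq_div_of_rpow_eq {p : ℝ} (hp : 1 < p) {N : ℕ} (hN : 0 < N) {d : ℕ → ℝ}
    (hd : ∀ i, 0 ≤ d i) {D : ℝ} (hD0 : 0 ≤ D) (hD : D ≤ ∑ i ∈ Finset.range N, d i)
    (h : D ^ p = (N : ℝ) ^ (p - 1) * ∑ i ∈ Finset.range N, d i ^ p) :
    ∀ i < N, d i = D / N := by
  have hNr : (0 : ℝ) < N := by exact_mod_cast hN
  have hp0 : 0 < p := by linarith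
  have hsc := strictConvexOn_rpow hp
  have hw1 : ∑ _i ∈ Finset.range N, (N : ℝ)⁻¹ = 1 := by
    rw [Finset.sum_const, Finset.card_range, nsmul_eq_mul, mul_inv_cancel₀ hNr.ne']
  have hav : D / N ≤ ∑ i ∈ Finset.range N, (N : ℝ)⁻¹ • d i := by
    rw [← Finset.smul_sum, smul_eq_mul, div_eq_inv_mul]
    gcongr
  have hjen : (∑ i ∈ Finset.range N, (N : ℝ)⁻¹ • d i) ^ p ≤
      ∑ i ∈ Finset.range N, (N : ℝ)⁻¹ • d i ^ p :=
    hsc.convexOn.map_sum_le (fun _ _ => (inv_pos.2 hNr).le) hw1 (fun i _ => hd i)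
  have hDp : (D / N) ^ p = ∑ i ∈ Finset.range N, (N : ℝ)⁻¹ • d i ^ p := by
    rw [Real.div_rpow hD0 hNr.le, h, ← Finset.smul_sum, smul_eq_mul, Real.rpow_sub_one hNr.ne']
    have : (N : ℝ) ^ p ≠ 0 := (Real.rpow_pos_of_pos hNr p).ne'
    field_simp
  have hDN : 0 ≤ D / N := div_nonneg hD0 hNr.le
  have hmono : (D / N) ^ p ≤ (∑ i ∈ Finset.range N, (N : ℝ)⁻¹ • d i) ^ p :=
    Real.rpow_le_rpow hDN hav hp0.le
  have heq : (∑ i ∈ Finset.range N, (N : ℝ)⁻¹ • d i) ^ p =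
      ∑ i ∈ Finset.range N, (N : ℝ)⁻¹ • d i ^ p := le_antisymm hjen (hDp ▸ hmono)
  have hall := (hsc.map_sum_eq_iff (fun _ _ => inv_pos.2 hNr) hw1 (fun i _ => hd i)).1 heq
  have hDav : D / N = ∑ i ∈ Finset.range N, (N : ℝ)⁻¹ • d i :=
    (Real.rpow_left_inj hDN (hDN.trans hav) hp0.ne').1 (hDp.trans heq.symm)
  intro i hi
  rw [hall i (Finset.mem_range.2 hi), hDav]

/-! ### Curves of measures induced by measures on geodesics -/

theorem edist_evalGeo_evalGeo {X : Type*} [MetricSpace X] (ξ : Geo X)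
    (s t : unitInterval) :
    edist (evalGeo s ξ) (evalGeo t ξ) =
      ENNReal.ofReal |(s : ℝ) - t| * edist (evalGeo 0 ξ) (evalGeo 1 ξ) := by
  rw [edist_dist, edist_dist, dist_evalGeo_evalGeo, ← ENNReal.ofReal_mul (abs_nonneg _), mul_comm]

theorem measurable_evalGeo {X : Type*} [MetricSpace X] [MeasurableSpace X] [BorelSpace X]
    (t : unitInterval) : Measurable (evalGeo (X := X) t) :=
  (continuous_evalGeo t).measurable

theorem nonempty_geo {X : Type*} [MetricSpace X] [Nonempty X] : Nonempty (Geo X) :=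
  ‹Nonempty X›.elim fun x => ⟨⟨ContinuousMap.const _ x, fun s t => by simp⟩⟩

/-- The distance to `A` is 1-Lipschitz, so at time `t` it is at most its value at time `0` plus the
length of the geodesic. At time `0` the part lying in `A` contributes nothing. -/
theorem lintegral_infEDist_evalGeo_lt_top {X : Type*} [MetricSpace X] [MeasurableSpace X]
    [BorelSpace X] {A : Set X} {p : ℝ} (hA : IsClosed A) (hp : 1 ≤ p) (μ : Mp A p)
    {Γ : Measure (Geo X)}
    (h0 : (Γ.map (evalGeo 0)).restrict Aᶜ = μ.1.map Subtype.val)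
    (hΓ : ∫⁻ ξ, edist (evalGeo 0 ξ) (evalGeo 1 ξ) ^ p ∂Γ < ∞) (t : unitInterval) :
    ∫⁻ x : Omega A, Metric.infEDist (x : X) A ^ p ∂(restrictTo Aᶜ (Γ.map (evalGeo t))) < ∞ := by
  have hp0 : 0 < p := by linarith
  have hAm := hA.measurableSet
  have hmeas : Measurable fun x : X => Metric.infEDist x A ^ p := measurable_infEDist.pow_const p
  have hinit : ∫⁻ ξ, Metric.infEDist (evalGeo 0 ξ) A ^ p ∂Γ < ∞ := by
    rw [← lintegral_map hmeas (measurable_evalGeo 0)]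
    have : ∫⁻ x, Metric.infEDist x A ^ p ∂(Γ.map (evalGeo 0)) =
        ∫⁻ x, Metric.infEDist x A ^ p ∂((Γ.map (evalGeo 0)).restrict Aᶜ) := by
      rw [← lintegral_indicator hAm.compl]
      refine lintegral_congr fun x => ?_
      by_cases hx : x ∈ A
      · simp [hx, Metric.infEDist_zero_of_mem hx, hp0]
      · simp [hx]
    rw [this, h0, (MeasurableEmbedding.subtype_coe hAm.compl).lintegral_map]
    exact μ.2.2
  rw [restrictTo, lintegral_subtype_comap hAm.compl fun x : X => Metric.infEDist x A ^ p]
  calc ∫⁻ x in Aᶜ, Metric.infEDist x A ^ p ∂(Γ.map (evalGeo t))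
      ≤ ∫⁻ x, Metric.infEDist x A ^ p ∂(Γ.map (evalGeo t)) := setLIntegral_le_lintegral _ _
    _ = ∫⁻ ξ, Metric.infEDist (evalGeo t ξ) A ^ p ∂Γ := lintegral_map hmeas (measurable_evalGeo t)
    _ ≤ ∫⁻ ξ, 2 ^ (p - 1) * (Metric.infEDist (evalGeo 0 ξ) A ^ p +
          edist (evalGeo 0 ξ) (evalGeo 1 ξ) ^ p) ∂Γ := by
        refine lintegral_mono fun ξ => ?_
        refine le_trans (ENNReal.rpow_le_rpow ?_ hp0.le)
          (ENNReal.rpow_add_le_mul_rpow_add_rpow _ _ hp)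
        refine (Metric.infEDist_le_infEDist_add_edist (y := evalGeo 0 ξ)).trans ?_
        gcongr
        rw [edist_evalGeo_evalGeo]
        refine mul_le_of_le_one_left zero_le (ENNReal.ofReal_le_one.2 ?_)
        simpa [abs_of_nonneg t.2.1] using t.2.2
    _ = 2 ^ (p - 1) * (∫⁻ ξ, Metric.infEDist (evalGeo 0 ξ) A ^ p ∂Γ +
          ∫⁻ ξ, edist (evalGeo 0 ξ) (evalGeo 1 ξ) ^ p ∂Γ) := by
        have hm0 : Measurable fun ξ : Geo X => Metric.infEDist (evalGeo 0 ξ) A ^ p :=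
          hmeas.comp (measurable_evalGeo 0)
        rw [lintegral_const_mul' _ _ (ENNReal.rpow_ne_top_of_nonneg (by linarith) (by simp)),
          lintegral_add_left hm0]
    _ < ∞ := ENNReal.mul_lt_top (ENNReal.rpow_lt_top_of_nonneg (by linarith) (by simp))
        (ENNReal.add_lt_top.2 ⟨hinit, hΓ⟩)

section Curves

variable {X : Type*} [MetricSpace X] [ProperSpace X] [MeasurableSpace X] [BorelSpace X]
  {A : Set X} {p : ℝ}

theorem Wb_comm (hA : IsClosed A) (hne : A.Nonempty) (hp : 1 ≤ p) (μ ν : Mp A p) :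
    Wb A p μ.1 ν.1 = Wb A p ν.1 μ.1 := by
  have hp0 : 0 < p := by linarith
  have key : ∀ μ ν : Mp A p, Wb A p μ.1 ν.1 ≤ Wb A p ν.1 μ.1 := by
    intro μ ν
    obtain ⟨Γ, hΓ, hΓc⟩ := exists_optimal_plan hA hne hp ν μ
    have hplan := isPlan_map_prodMk measurable_snd measurable_fst hΓ.snd hΓ.fst
    have h := hplan.Wb_rpow_le hA.measurableSet hp
    rw [lintegral_map (measurable_edist_rpow p) (measurable_snd.prodMk measurable_fst)] at h
    refine (ENNReal.rpow_le_rpow_iff hp0).1 (h.trans ?_)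
    rw [← hΓc]
    exact (lintegral_congr fun z : X × X => congrArg (· ^ p) (edist_comm z.2 z.1)).le
  exact le_antisymm (key μ ν) (key ν μ)

/-- On a compact subset of `Ω` the distance to `A` has a positive minimum, so Markov's inequality
bounds the mass. Inner regularity then comes from local finiteness. -/
theorem isRadon_of_lintegral_lt_top (hA : IsClosed A) (hp : 1 ≤ p) {ν : Measure (Omega A)}
    (h : ∫⁻ x : Omega A, Metric.infEDist (x : X) A ^ p ∂ν < ∞) : IsRadon ν := by
  have hp0 : 0 < p := by linarith
  have hcont : Continuous fun x : Omega A => Metric.infEDist (x : X) A :=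
    Metric.continuous_infEDist.comp continuous_subtype_val
  have hfin : IsFiniteMeasureOnCompacts ν := by
    refine ⟨fun K hK => ?_⟩
    rcases K.eq_empty_or_nonempty with rfl | hKn
    · simp
    obtain ⟨x₀, _, hmin⟩ := hK.exists_isMinOn hKn hcont.continuousOn
    have hpos : Metric.infEDist (x₀ : X) A ^ p ≠ 0 := by
      have : Metric.infEDist (x₀ : X) A ≠ 0 := fun h0 =>
        x₀.2 ((Metric.mem_iff_infEDist_zero_of_closed hA).2 h0)
      simp [this, hp0.not_gt]
    have hle : Metric.infEDist (x₀ : X) A ^ p * ν K ≤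
        ∫⁻ x : Omega A, Metric.infEDist (x : X) A ^ p ∂ν := by
      refine le_trans ?_ (mul_meas_ge_le_lintegral (hcont.measurable.pow_const p)
        (Metric.infEDist (x₀ : X) A ^ p))
      gcongr
      exact fun x hx => ENNReal.rpow_le_rpow (hmin hx) hp0.le
    exact ENNReal.lt_top_of_mul_ne_top_right (hle.trans_lt h).ne hpos
  have : LocallyCompactSpace (Omega A) := hA.isOpen_compl.locallyCompactSpace
  exact ⟨hfin, inferInstance⟩

/-- A measure on geodesics with finite cost induces a Lipschitz curve in `Mp A p`. -/
theorem exists_curve (hA : IsClosed A) (hp : 1 ≤ p) (μ : Mp A p) {Γ : Measure (Geo X)}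
    (h0 : (Γ.map (evalGeo 0)).restrict Aᶜ = μ.1.map Subtype.val) {W : ℝ≥0∞} (hW : W ≠ ∞)
    (hΓ : ∫⁻ ξ, edist (evalGeo 0 ξ) (evalGeo 1 ξ) ^ p ∂Γ ≤ W ^ p) :
    ∃ ρ : unitInterval → Mp A p, (∀ t, (ρ t).1 = restrictTo Aᶜ (Γ.map (evalGeo t))) ∧
      ∀ s t, Wb A p (ρ s).1 (ρ t).1 ≤ ENNReal.ofReal |(s : ℝ) - t| * W := by
  have hp0 : 0 < p := by linarith
  have hAm := hA.measurableSet
  have hfin := lintegral_infEDist_evalGeo_lt_top hA hp μ h0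
    (hΓ.trans_lt (ENNReal.rpow_lt_top_of_nonneg hp0.le hW))
  refine ⟨fun t => ⟨_, isRadon_of_lintegral_lt_top hA hp (hfin t), hfin t⟩, fun t => rfl,
    fun s t => ?_⟩
  have hplan := isPlan_map_prodMk (σ := Γ) (measurable_evalGeo s) (measurable_evalGeo t)
    ((restrictTo_eq_iff hAm.compl _ _).1 rfl) ((restrictTo_eq_iff hAm.compl _ _).1 rfl)
  rw [← ENNReal.rpow_le_rpow_iff hp0]
  refine (hplan.Wb_rpow_le hAm hp).trans ?_
  rw [lintegral_map (measurable_edist_rpow p) ((measurable_evalGeo s).prodMk (measurable_evalGeo t)),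
    ENNReal.mul_rpow_of_nonneg _ _ hp0.le]
  calc ∫⁻ ξ, edist (evalGeo s ξ) (evalGeo t ξ) ^ p ∂Γ
      = ∫⁻ ξ, ENNReal.ofReal |(s : ℝ) - t| ^ p * edist (evalGeo 0 ξ) (evalGeo 1 ξ) ^ p ∂Γ := by
        refine lintegral_congr fun ξ => ?_
        rw [edist_evalGeo_evalGeo, ENNReal.mul_rpow_of_nonneg _ _ hp0.le]
    _ = ENNReal.ofReal |(s : ℝ) - t| ^ p *
          ∫⁻ ξ, edist (evalGeo 0 ξ) (evalGeo 1 ξ) ^ p ∂Γ :=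
        lintegral_const_mul' _ _ (ENNReal.rpow_ne_top_of_nonneg hp0.le ENNReal.ofReal_ne_top)
    _ ≤ _ := by gcongr

/-- An optimal plan is transported along Borel-chosen geodesics. As `(e₀,e₁)` is onto, the section
is a genuine right inverse and the plan is recovered from the endpoints. -/
theorem isGeodesicSpace_Mp (hA : IsClosed A) (hne : A.Nonempty) (hp : 1 ≤ p)
    (hX : IsGeodesicSpace X) : IsGeodesicSpace (Mp A p) := by
  intro μ ν
  have hp0 : 0 < p := by linarith
  have hAm := hA.measurableSet
  have : Nonempty X := hne.to_type
  have : Nonempty (Geo X) := nonempty_geo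
  obtain ⟨γ, hγ, hγc⟩ := exists_optimal_plan hA hne hp μ ν
  set W := Wb A p μ.1 ν.1 with hW
  have hWtop : W ≠ ∞ := Wb_ne_top hA hne hp μ ν
  obtain ⟨S, hS, hSF⟩ := exists_measurable_section (G := Geo X) (Y := X × X)
    (F := fun ξ => (evalGeo 0 ξ, evalGeo 1 ξ)) ((continuous_evalGeo 0).prodMk (continuous_evalGeo 1))
  have hSF' : ∀ z, (evalGeo 0 (S z), evalGeo 1 (S z)) = z := by
    intro z
    obtain ⟨ξ, hξ, hξ0, hξ1⟩ := hX z.1 z.2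
    refine hSF z ⟨⟨⟨ξ, hξ.continuous⟩, hξ⟩, ?_⟩
    exact Prod.ext hξ0 hξ1
  have hS0 : evalGeo 0 ∘ S = Prod.fst := funext fun z => congrArg Prod.fst (hSF' z)
  have hS1 : evalGeo 1 ∘ S = Prod.snd := funext fun z => congrArg Prod.snd (hSF' z)
  have hm0 : (γ.map S).map (evalGeo 0) = γ.map Prod.fst := by
    rw [Measure.map_map (measurable_evalGeo 0) hS, hS0]
  have hm1 : (γ.map S).map (evalGeo 1) = γ.map Prod.snd := by
    rw [Measure.map_map (measurable_evalGeo 1) hS, hS1]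
  have hcost : ∫⁻ ξ, edist (evalGeo 0 ξ) (evalGeo 1 ξ) ^ p ∂(γ.map S) ≤ W ^ p := by
    have hm : Measurable fun ξ : Geo X => edist (evalGeo 0 ξ) (evalGeo 1 ξ) ^ p :=
      (measurable_edist_rpow p).comp ((measurable_evalGeo 0).prodMk (measurable_evalGeo 1))
    rw [lintegral_map hm hS, ← hγc]
    refine (lintegral_congr fun z => ?_).le
    have h0 := congrArg Prod.fst (hSF' z)
    have h1 := congrArg Prod.snd (hSF' z)
    simp only at h0 h1
    rw [h0, h1]
  obtain ⟨ρ, hρ, hρW⟩ := exists_curve hA hp μ (by rw [hm0, hγ.fst]) hWtop hcost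
  have hρ0 : ρ 0 = μ := Subtype.ext <| by
    rw [hρ, hm0, restrictTo_eq_iff hAm.compl, hγ.fst]
  have hρ1 : ρ 1 = ν := Subtype.ext <| by
    rw [hρ, hm1, restrictTo_eq_iff hAm.compl, hγ.snd]
  have hdist : ∀ μ ν : Mp A p, dist μ ν = (Wb A p μ.1 ν.1).toReal := fun _ _ => rfl
  have htri : ∀ μ ν ρ : Mp A p, dist μ ρ ≤ dist μ ν + dist ν ρ := by
    intro μ ν ρ
    have h1 := Wb_ne_top hA hne hp μ ν
    have h2 := Wb_ne_top hA hne hp ν ρ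
    rw [hdist, hdist, hdist, ← ENNReal.toReal_add h1 h2]
    exact ENNReal.toReal_mono (ENNReal.add_ne_top.2 ⟨h1, h2⟩) (Wb_triangle hA hne hp μ ν ρ)
  have hle : ∀ s t, dist (ρ s) (ρ t) ≤ dist μ ν * |(s : ℝ) - t| := by
    intro s t
    have := ENNReal.toReal_mono (ENNReal.mul_ne_top ENNReal.ofReal_ne_top hWtop) (hρW s t)
    rwa [ENNReal.toReal_mul, ENNReal.toReal_ofReal (abs_nonneg _), mul_comm] at this
  have hcomm : ∀ μ ν : Mp A p, dist μ ν = dist ν μ := fun μ ν => by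
    rw [hdist, hdist, Wb_comm hA hne hp]
  -- The upper bounds on `[0,s]`, `[s,t]` and `[t,1]` add up to the full distance, so the middle one
  -- is attained.
  have hge : ∀ s t : unitInterval, (s : ℝ) ≤ t → dist μ ν * |(s : ℝ) - t| ≤ dist (ρ s) (ρ t) := by
    intro s t hst
    have h1 := hle 0 s
    have h2 := hle t 1
    have h3 := htri (ρ 0) (ρ s) (ρ 1)
    have h4 := htri (ρ s) (ρ t) (ρ 1)
    rw [hρ0] at h1 h3
    rw [hρ1] at h2 h3 h4
    simp only [Set.Icc.coe_zero, Set.Icc.coe_one] at h1 h2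
    rw [abs_of_nonpos (by linarith [s.2.1])] at h1
    rw [abs_of_nonpos (by linarith [t.2.2])] at h2
    rw [abs_of_nonpos (by linarith)]
    nlinarith
  refine ⟨ρ, fun s t => ?_, hρ0, hρ1⟩
  rw [hρ0, hρ1]
  refine le_antisymm (hle s t) ?_
  rcases le_total (s : ℝ) t with h | h
  · exact hge s t h
  · rw [abs_sub_comm, hcomm (ρ s)]
    exact hge t s h

end Curves

/-! ### Lifting geodesics of measures -/

/-- The point `i / N` of the unit interval (or `1` if `N < i`). -/
noncomputable def gridPt (N i : ℕ) : unitInterval := Set.projIcc 0 1 zero_le_one ((i : ℝ) / N)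

theorem coe_gridPt {N i : ℕ} (hi : i ≤ N) : (gridPt N i : ℝ) = i / N := by
  have h : (i : ℝ) / N ∈ Set.Icc (0 : ℝ) 1 :=
    ⟨by positivity, div_le_one_of_le₀ (by exact_mod_cast hi) (by positivity)⟩
  rw [gridPt, Set.projIcc_of_mem _ h]

theorem gridPt_zero (N : ℕ) : gridPt N 0 = 0 := Subtype.ext <| by
  rw [coe_gridPt (Nat.zero_le _)]
  simp

theorem gridPt_self {N : ℕ} (hN : 0 < N) : gridPt N N = 1 := Subtype.ext <| by
  have : (N : ℝ) ≠ 0 := by exact_mod_cast hN.ne'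
  rw [coe_gridPt le_rfl, div_self this]
  rfl

/-- Dyadic grids are nested, so a marginal condition at a fixed dyadic time holds for all
sufficiently fine lifts. -/
theorem exists_gridPt_two_pow_eq {m n : ℕ} (hmn : m ≤ n) (k : ℕ) :
    ∃ i ≤ 2 ^ n, gridPt (2 ^ m) k = gridPt (2 ^ n) i := by
  rcases le_total k (2 ^ m) with h | h
  · obtain ⟨l, rfl⟩ := Nat.exists_eq_add_of_le hmn
    have hi : k * 2 ^ l ≤ 2 ^ (m + l) := by
      rw [pow_add]
      gcongr
    refine ⟨k * 2 ^ l, hi, Subtype.ext ?_⟩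
    rw [coe_gridPt h, coe_gridPt hi]
    push_cast
    rw [pow_add, mul_div_mul_right _ _ (by positivity)]
  · refine ⟨2 ^ n, le_rfl, ?_⟩
    have h1 : (1 : ℝ) ≤ k / (2 ^ m : ℕ) := by
      rw [le_div_iff₀ (by positivity), one_mul]
      exact_mod_cast h
    rw [gridPt_self (by positivity), gridPt, Set.projIcc_of_right_le _ h1]
    rfl

theorem exists_gridPt_two_pow_near (t : unitInterval) (m : ℕ) :
    ∃ k, |(t : ℝ) - gridPt (2 ^ m) k| ≤ (1 / 2) ^ m := by
  have hpos : (0 : ℝ) < 2 ^ m := by positivity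
  have h0 : (0 : ℝ) ≤ t * 2 ^ m := mul_nonneg t.2.1 hpos.le
  have hle : ⌊(t : ℝ) * 2 ^ m⌋₊ ≤ 2 ^ m := by
    refine (Nat.floor_le_floor (mul_le_of_le_one_left hpos.le t.2.2)).trans (le_of_eq ?_)
    rw [show (2 : ℝ) ^ m = ((2 ^ m : ℕ) : ℝ) by push_cast; rfl, Nat.floor_natCast]
  refine ⟨⌊(t : ℝ) * 2 ^ m⌋₊, ?_⟩
  rw [coe_gridPt hle]
  push_cast
  have h1 := Nat.floor_le h0
  have h2 := Nat.lt_floor_add_one ((t : ℝ) * 2 ^ m)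
  have heq : (t : ℝ) - ⌊(t : ℝ) * 2 ^ m⌋₊ / 2 ^ m = (t * 2 ^ m - ⌊(t : ℝ) * 2 ^ m⌋₊) / 2 ^ m := by
    field_simp
  rw [heq, abs_of_nonneg (div_nonneg (sub_nonneg.2 h1) hpos.le), div_pow, one_pow]
  gcongr
  linarith

/-- A geodesic of length at most `R` stays within `R` of its position at time `t`, so these
geodesics form a closed bounded set in the proper space `Geo X`. -/
theorem isCompact_setOf_evalGeo_mem {X : Type*} [MetricSpace X] [ProperSpace X] (t : unitInterval)
    {K : Set X} (hK : IsCompact K) (R : ℝ) :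
    IsCompact {ξ : Geo X | evalGeo t ξ ∈ K ∧ dist (evalGeo 0 ξ) (evalGeo 1 ξ) ≤ R} := by
  have hcl : IsClosed {ξ : Geo X | dist (evalGeo 0 ξ) (evalGeo 1 ξ) ≤ R} :=
    isClosed_le ((continuous_evalGeo 0).dist (continuous_evalGeo 1)) continuous_const
  refine Metric.isCompact_of_isClosed_isBounded
    ((hK.isClosed.preimage (continuous_evalGeo t)).inter hcl) ?_
  rw [Metric.isBounded_iff]
  have hspeed : ∀ (ξ : Geo X), dist (evalGeo 0 ξ) (evalGeo 1 ξ) ≤ R → ∀ s,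
      dist (evalGeo s ξ) (evalGeo t ξ) ≤ R := by
    intro ξ hξ s
    rw [dist_evalGeo_evalGeo]
    refine (mul_le_of_le_one_right dist_nonneg ?_).trans hξ
    rw [abs_le]
    constructor <;> linarith [s.2.1, s.2.2, t.2.1, t.2.2]
  refine ⟨R + Metric.diam K + R, fun ξ hξ η hη => ?_⟩
  have hR : 0 ≤ R := dist_nonneg.trans hξ.2
  refine (ContinuousMap.dist_le (add_nonneg (add_nonneg hR Metric.diam_nonneg) hR)).2 fun s => ?_
  refine (dist_triangle4 (evalGeo s ξ) (evalGeo t ξ) (evalGeo t η) (evalGeo s η)).trans ?_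
  rw [dist_comm (evalGeo t η)]
  exact add_le_add (add_le_add (hspeed ξ hξ.2 s) (Metric.dist_le_diam_of_mem hK.isBounded hξ.1 hη.1))
    (hspeed η hη.2 s)

section Lifting

variable {X : Type*} [MetricSpace X] [ProperSpace X] [MeasurableSpace X] [BorelSpace X]
  {A : Set X} {p : ℝ}

theorem IsGeodesicCurve.Wb_eq (hA : IsClosed A) (hne : A.Nonempty) (hp : 1 ≤ p)
    {μ : unitInterval → Mp A p} (hμ : IsGeodesicCurve μ) (s t : unitInterval) :
    Wb A p (μ s).1 (μ t).1 = ENNReal.ofReal |(s : ℝ) - t| * Wb A p (μ 0).1 (μ 1).1 := by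
  have h : (Wb A p (μ s).1 (μ t).1).toReal =
      (Wb A p (μ 0).1 (μ 1).1).toReal * |(s : ℝ) - t| := hμ s t
  rw [← ENNReal.toReal_eq_toReal_iff' (Wb_ne_top hA hne hp _ _)
    (ENNReal.mul_ne_top ENNReal.ofReal_ne_top (Wb_ne_top hA hne hp _ _)), h, ENNReal.toReal_mul,
    ENNReal.toReal_ofReal (abs_nonneg _), mul_comm]

/-- An optimal chain along a geodesic is concentrated on discrete geodesics. -/
theorem exists_geodesic_chain (hA : IsClosed A) (hne : A.Nonempty) (hp : 1 < p)
    {μ : unitInterval → Mp A p} (hμ : IsGeodesicCurve μ) {N : ℕ} (hN : 0 < N) :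
    ∃ σ : Measure (ℕ → X),
      (∀ i ≤ N, (σ.map fun z => z i).restrict Aᶜ = (μ (gridPt N i)).1.map Subtype.val) ∧
      (∀ᵐ z ∂σ, ∀ i < N, dist (z i) (z (i + 1)) = dist (z 0) (z N) / N) ∧
      ∫⁻ z, edist (z 0) (z N) ^ p ∂σ = Wb A p (μ 0).1 (μ 1).1 ^ p := by
  have hp0 : 0 < p := by linarith
  have hNr : (0 : ℝ) < N := by exact_mod_cast hN
  have hN0 : (N : ℝ≥0∞) ≠ 0 := by exact_mod_cast hN.ne'
  have hNt : (N : ℝ≥0∞) ≠ ∞ := ENNReal.natCast_ne_top N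
  set W := Wb A p (μ 0).1 (μ 1).1 with hW
  have hWt : W ≠ ∞ := Wb_ne_top hA hne hp.le _ _
  obtain ⟨σ, hσ, hσc⟩ := exists_optimal_chain hA hne hp.le (fun i => μ (gridPt N i)) N
  have hstep : ∀ i < N, ∫⁻ z, edist (z i) (z (i + 1)) ^ p ∂σ = W ^ p / (N : ℝ≥0∞) ^ p := by
    intro i hi
    rw [hσc i hi, hμ.Wb_eq hA hne hp.le, ← hW, coe_gridPt hi.le, coe_gridPt hi]
    have : |(i : ℝ) / N - ((i + 1 : ℕ) : ℝ) / N| = (N : ℝ)⁻¹ := by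
      rw [← sub_div, abs_div, abs_of_pos hNr]
      push_cast
      simp
    rw [this, ENNReal.ofReal_inv_of_pos hNr, ENNReal.ofReal_natCast, mul_comm, ← div_eq_mul_inv,
      ENNReal.div_rpow_of_nonneg _ _ hp0.le]
  have hev : ∀ i : ℕ, Measurable fun z : ℕ → X => z i := fun i => measurable_pi_apply i
  have hed : ∀ i j : ℕ, Measurable fun z : ℕ → X => edist (z i) (z j) ^ p := fun i j =>
    ((hev i).edist (hev j)).pow_const p
  let f : (ℕ → X) → ℝ≥0∞ := fun z => edist (z 0) (z N) ^ p
  let g : (ℕ → X) → ℝ≥0∞ := fun z =>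
    (N : ℝ≥0∞) ^ (p - 1) * ∑ i ∈ Finset.range N, edist (z i) (z (i + 1)) ^ p
  have hg : Measurable g :=
    (Finset.measurable_sum _ fun i _ => hed i (i + 1)).const_mul _
  have hfg : ∀ z, f z ≤ g z := fun z => by
    refine (ENNReal.rpow_le_rpow (edist_le_range_sum_edist z N) hp0.le).trans ?_
    simpa using ENNReal.rpow_sum_le_const_mul_sum_rpow (Finset.range N)
      (fun i => edist (z i) (z (i + 1))) hp.le
  have hgint : ∫⁻ z, g z ∂σ = W ^ p := by
    have hN1 : (N : ℝ≥0∞) ^ (p - 1) * N = (N : ℝ≥0∞) ^ p := by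
      have := ENNReal.rpow_add (p - 1) 1 hN0 hNt
      rw [sub_add_cancel, ENNReal.rpow_one] at this
      exact this.symm
    rw [lintegral_const_mul _ (Finset.measurable_sum _ fun i _ => hed i (i + 1)),
      lintegral_finsetSum _ fun i _ => hed i (i + 1),
      Finset.sum_congr rfl fun i hi => hstep i (Finset.mem_range.1 hi), Finset.sum_const,
      Finset.card_range, nsmul_eq_mul, ← mul_assoc, hN1]
    refine ENNReal.mul_div_cancel ?_ (ENNReal.rpow_ne_top_of_nonneg hp0.le hNt)
    exact (ENNReal.rpow_pos (pos_iff_ne_zero.2 hN0) hNt).ne'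
  -- The endpoints of the chain give an admissible plan from `μ 0` to `μ 1`, so `f` cannot integrate
  -- to less than `W ^ p`, the integral of `g`. With `f ≤ g` and finite integrals, `f = g` almost
  -- everywhere.
  have hfint : W ^ p ≤ ∫⁻ z, f z ∂σ := by
    have h0 := hσ 0 (Nat.zero_le _)
    have h1 := hσ N le_rfl
    rw [gridPt_zero] at h0
    rw [gridPt_self hN] at h1
    have := (isPlan_map_prodMk (hev 0) (hev N) h0 h1).Wb_rpow_le hA.measurableSet hp.le
    rwa [lintegral_map (measurable_edist_rpow p) ((hev 0).prodMk (hev N))] at this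
  have hfeq : ∫⁻ z, f z ∂σ = W ^ p := le_antisymm ((lintegral_mono hfg).trans hgint.le) hfint
  refine ⟨σ, hσ, ?_, hfeq⟩
  have hae : f =ᵐ[σ] g := ae_eq_of_ae_le_of_lintegral_le (ae_of_all _ hfg)
    (hfeq ▸ ENNReal.rpow_ne_top_of_nonneg hp0.le hWt) hg.aemeasurable (hgint.le.trans hfint)
  filter_upwards [hae] with z hz
  refine eq_div_of_rpow_eq hp hN (d := fun i => dist (z i) (z (i + 1))) (fun _ => dist_nonneg)
    dist_nonneg (dist_le_range_sum_dist z N) ?_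
  have hreal : ∀ x y : X, (edist x y ^ p).toReal = dist x y ^ p := fun x y => by
    rw [← ENNReal.toReal_rpow, ← dist_edist]
  have := congrArg ENNReal.toReal hz
  simp only [f, g] at this
  rw [hreal, ENNReal.toReal_mul, ENNReal.toReal_sum fun i _ =>
    ENNReal.rpow_ne_top_of_nonneg hp0.le (edist_ne_top _ _), ← ENNReal.toReal_rpow,
    ENNReal.toReal_natCast] at this
  simpa only [hreal] using this

/-- The lift of a geodesic of measures, along a finite grid of times. -/
theorem exists_lift_on_grid (hA : IsClosed A) (hne : A.Nonempty) (hp : 1 < p)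
    (hX : IsGeodesicSpace X) {μ : unitInterval → Mp A p} (hμ : IsGeodesicCurve μ) {N : ℕ}
    (hN : 0 < N) :
    ∃ Γ : Measure (Geo X),
      (∀ i ≤ N, (Γ.map (evalGeo (gridPt N i))).restrict Aᶜ =
        (μ (gridPt N i)).1.map Subtype.val) ∧
      ∫⁻ ξ, edist (evalGeo 0 ξ) (evalGeo 1 ξ) ^ p ∂Γ = Wb A p (μ 0).1 (μ 1).1 ^ p := by
  have : Nonempty X := hne.to_type
  have : Nonempty (Geo X) := nonempty_geo
  obtain ⟨σ, hσ, hσg, hσc⟩ := exists_geodesic_chain hA hne hp hμ hN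
  obtain ⟨S, hS, hSF⟩ := exists_measurable_section (G := Geo X) (Y := Fin (N + 1) → X)
    (F := fun ξ i => evalGeo (gridPt N i) ξ) (continuous_pi fun i => continuous_evalGeo _)
  let r : (ℕ → X) → Fin (N + 1) → X := fun z i => z i
  have hr : Measurable r := measurable_pi_lambda _ fun i => measurable_pi_apply (i : ℕ)
  have hSr : Measurable fun z => S (r z) := hS.comp hr
  -- Almost every chain is a discrete geodesic, hence is sampled from a true geodesic and lies in
  -- the range where `S` is a section; its values elsewhere do not matter.
  have hae : ∀ᵐ z ∂σ, ∀ i ≤ N, evalGeo (gridPt N i) (S (r z)) = z i := by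
    filter_upwards [hσg] with z hz i hi
    obtain ⟨ξ, hξ⟩ := exists_geo_of_discrete hX hN z hz
    have hmem : r z ∈ Set.range fun (ξ : Geo X) (i : Fin (N + 1)) => evalGeo (gridPt N i) ξ :=
      ⟨ξ, funext fun j => hξ _ j (coe_gridPt (Nat.lt_succ_iff.1 j.2))⟩
    exact congrFun (hSF _ hmem) ⟨i, Nat.lt_succ_iff.2 hi⟩
  refine ⟨σ.map fun z => S (r z), fun i hi => ?_, ?_⟩
  · rw [Measure.map_map (measurable_evalGeo _) hSr, ← hσ i hi]
    congr 1
    refine Measure.map_congr ?_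
    filter_upwards [hae] with z hz
    exact hz i hi
  · have hm : Measurable fun ξ : Geo X => edist (evalGeo 0 ξ) (evalGeo 1 ξ) ^ p :=
      (measurable_edist_rpow p).comp ((measurable_evalGeo 0).prodMk (measurable_evalGeo 1))
    rw [lintegral_map hm hSr, ← hσc]
    refine lintegral_congr_ae ?_
    filter_upwards [hae] with z hz
    have h0 := hz 0 (Nat.zero_le _)
    have h1 := hz N le_rfl
    rw [gridPt_zero] at h0
    rw [gridPt_self hN] at h1
    rw [h0, h1]

theorem exists_lift_of_isGeodesicCurve (hA : IsClosed A) (hne : A.Nonempty) (hp : 1 < p)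
    (hX : IsGeodesicSpace X) {μ : unitInterval → Mp A p} (hμ : IsGeodesicCurve μ) :
    ∃ γ : Measure (Geo X),
      restrictTo (EOmega A) (γ.map (fun ξ => (evalGeo 0 ξ, evalGeo 1 ξ)))
        ∈ Opt A p (μ 0).1 (μ 1).1 ∧
      ∀ t : unitInterval, (μ t).1 = restrictTo (Omega A) (γ.map (evalGeo t)) := by
  have hp0 : 0 < p := by linarith
  have hAm := hA.measurableSet
  set W := Wb A p (μ 0).1 (μ 1).1 with hW
  have hWt : W ≠ ∞ := Wb_ne_top hA hne hp.le _ _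
  choose Γ hΓ hΓc using fun n : ℕ =>
    exists_lift_on_grid hA hne hp hX hμ (N := 2 ^ n) (by positivity)
  let c : Geo X → ℝ≥0 := fun ξ => nndist (evalGeo 0 ξ) (evalGeo 1 ξ) ^ p
  have hc : Continuous c := (NNReal.continuous_rpow_const hp0.le).comp
    ((continuous_evalGeo 0).nndist (continuous_evalGeo 1))
  have hcedist : ∀ ξ, (c ξ : ℝ≥0∞) = edist (evalGeo 0 ξ) (evalGeo 1 ξ) ^ p := fun ξ => by
    rw [edist_nndist, ENNReal.coe_rpow_of_nonneg _ hp0.le]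
  -- The index `(m, k)` stands for the time `k / 2^m`: the limit inherits the marginals at all
  -- dyadic times at once.
  obtain ⟨G, hG, hGc⟩ := exists_limit_of_marginals hA (I := ℕ × ℕ)
    (e := fun q => evalGeo (gridPt (2 ^ q.1) q.2)) (fun q => continuous_evalGeo _) hc
    (by
      intro q K R hK
      have hcl : IsClosed {ξ | c ξ ≤ R} := isClosed_le hc continuous_const
      refine (isCompact_setOf_evalGeo_mem (gridPt (2 ^ q.1) q.2) hK
        ((R ^ (1 / p) : ℝ≥0) : ℝ)).of_isClosed_subset
        ((hK.isClosed.preimage (continuous_evalGeo _)).inter hcl) ?_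
      rintro ξ ⟨hξ, hξR⟩
      have hd : nndist (evalGeo 0 ξ) (evalGeo 1 ξ) ≤ R ^ (1 / p) := by
        have := NNReal.rpow_le_rpow hξR (show 0 ≤ 1 / p by positivity)
        rwa [← NNReal.rpow_mul, mul_one_div_cancel hp0.ne', NNReal.rpow_one] at this
      exact ⟨hξ, hd⟩)
    (fun q => (μ (gridPt (2 ^ q.1) q.2)).1.map Subtype.val)
    (fun q K hK hKA => (μ _).map_val_ne_top hK hKA) Γ
    (by
      rintro ⟨m, k⟩
      filter_upwards [eventually_ge_atTop m] with n hn
      obtain ⟨i, hi, hik⟩ := exists_gridPt_two_pow_eq hn k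
      simp only [hik, restrict_map_val hAm]
      exact hΓ n i hi)
    (fun _ => W ^ p) (W ^ p) (ENNReal.rpow_ne_top_of_nonneg hp0.le hWt) tendsto_const_nhds
    (fun n => by simpa only [hcedist] using (hΓc n).le)
  simp only [restrict_map_val hAm] at hG
  simp only [hcedist] at hGc
  have h0 : (G.map (evalGeo 0)).restrict Aᶜ = (μ 0).1.map Subtype.val := by
    simpa only [gridPt_zero] using hG (0, 0)
  have h1 : (G.map (evalGeo 1)).restrict Aᶜ = (μ 1).1.map Subtype.val := by
    simpa only [pow_zero, gridPt_self one_pos] using hG (0, 1)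
  have hm01 : Measurable fun ξ : Geo X => (evalGeo 0 ξ, evalGeo 1 ξ) :=
    (measurable_evalGeo 0).prodMk (measurable_evalGeo 1)
  refine ⟨G, ?_, ?_⟩
  · refine (isPlan_map_prodMk (measurable_evalGeo 0) (measurable_evalGeo 1) h0 h1).restrictTo_mem_Opt
      hAm hp.le ?_
    rwa [lintegral_map (measurable_edist_rpow p) hm01]
  -- At other times the marginal of `G` is identified by density: `ρ` and `μ` are both `W`-Lipschitz
  -- and agree at a dyadic time within `2^(-m)` of `t`.
  · obtain ⟨ρ, hρ, hρW⟩ := exists_curve hA hp.le (μ 0) h0 hWt hGc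
    have hgrid : ∀ m k, ρ (gridPt (2 ^ m) k) = μ (gridPt (2 ^ m) k) := fun m k =>
      Subtype.ext <| by
        rw [hρ, restrictTo_eq_iff hAm.compl]
        exact hG (m, k)
    intro t
    rw [← hρ t]
    refine eq_of_Wb_eq_zero hA hne hp.le _ _ ?_
    have hle : ∀ m : ℕ, Wb A p (μ t).1 (ρ t).1 ≤ ENNReal.ofReal ((1 / 2) ^ m) * W +
        ENNReal.ofReal ((1 / 2) ^ m) * W := by
      intro m
      obtain ⟨k, hk⟩ := exists_gridPt_two_pow_near t m
      refine (Wb_triangle hA hne hp.le (μ t) (μ (gridPt (2 ^ m) k)) (ρ t)).trans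
        (add_le_add ?_ ?_)
      · rw [hμ.Wb_eq hA hne hp.le]
        gcongr
      · rw [← hgrid]
        refine (hρW _ _).trans ?_
        rw [abs_sub_comm]
        gcongr
    have hlim : Tendsto (fun m : ℕ => ENNReal.ofReal ((1 / 2) ^ m) * W +
        ENNReal.ofReal ((1 / 2) ^ m) * W) atTop (𝓝 0) := by
      have h2 : Tendsto (fun m : ℕ => ENNReal.ofReal ((1 / 2) ^ m)) atTop (𝓝 0) := by
        rw [← ENNReal.ofReal_zero]
        exact ENNReal.tendsto_ofReal
          (tendsto_pow_atTop_nhds_zero_of_lt_one (by norm_num) (by norm_num))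
      have h3 := ENNReal.Tendsto.mul_const (b := W) h2 (Or.inr hWt)
      rw [zero_mul] at h3
      simpa using h3.add h3
    exact le_antisymm (ge_of_tendsto' hlim hle) zero_le

end Lifting

end PartialTransport

theorem mainTheorem2 {X : Type*} [MetricSpace X] [ProperSpace X] [MeasurableSpace X] [BorelSpace X]
    (A : Set X) (hA : IsClosed A) (hne : A.Nonempty) (p : ℝ) (hp : 1 ≤ p)
    (hX : IsGeodesicSpace X) :
    IsGeodesicSpace (Mp A p) ∧
    (1 < p → ∀ μ : unitInterval → Mp A p, IsGeodesicCurve μ →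
      ∃ γ : Measure (Geo X),
        restrictTo (EOmega A) (γ.map (fun ξ => (evalGeo 0 ξ, evalGeo 1 ξ)))
          ∈ Opt A p (μ 0).1 (μ 1).1 ∧
        ∀ t : unitInterval, (μ t).1 = restrictTo (Omega A) (γ.map (evalGeo t))) :=
  ⟨isGeodesicSpace_Mp hA hne hp hX, fun hp1 _ hμ =>
    exists_lift_of_isGeodesicCurve hA hne hp1 hX hμ⟩
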